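/- Write $(z;q)_\infty=\prod_{j\ge 0}(1-zq^j)$ for $|q|<1$, let $\operatorname{PV}\prod_{n\in\mathbb Z}$ and $\operatorname{PV}\sum_{n\in\mathbb Z}$ denote the limit as $N\to\infty$ of the product or sum over $-N\le n\le N$, and let $\operatorname{Li}_2(z)=-\int_0^1\log(1-zu)\,\frac{du}{u}$ be the principal branch of the dilogarithm (so $\operatorname{Li}_2(z)=\sum_{n\ge1}z^n/n^2$ for $|z|\le 1$). All logarithms $\log$ are principal, with argument in $(-\pi,\pi]$, and $w^{1/2}=\exp(\frac12\log w)$. Let $\beta\in\mathbb C$ with $\operatorname{Re}\beta>0$, and for $y\in\mathbb C$ put $x_n=(y+2\pi\mathrm i n)/\beta$. (1) For every $y\notin 2\pi\mathrm i\mathbb Z$, $$\operatorname{PV}\sum_{n\in\mathbb Z}\frac{\beta}{12(y+2\pi\mathrm i n)}=\frac{\beta\coth(y/2)}{24}.$$ (2) For every $y\notin 2\pi\mathrm i\mathbb Z$, the principal-value product below converges and $$(e^{-y};e^{-\beta})_\infty=(1-e^{-y})^{1/2}\exp\left(\frac{\beta}{24}-\frac{\operatorname{Li}_2(e^{-y})}{\beta}\right)\operatorname{PV}\prod_{n\in\mathbb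 Z}\left(\frac{\sqrt{2\pi}}{\Gamma(x_n)}\,x_n^{x_n-\frac12}\,e^{-x_n}\right),$$ where $1/\Gamma$ is the entire reciprocal gamma function and the branch of the power is $x_n^{x_n-1/2}=\exp\big((x_n-\tfrac12)(\log(y+2\pi\mathrm i n)-\log\beta)\big)$, which is positive for $x_n>0$ and is the principal power if $\operatorname{Re}y>0$ or if $\beta>0$. More generally, the identity in (2) is an identity of multivalued analytic functions on $\mathbb C\setminus 2\pi\mathrm i\mathbb Z$: if $\gamma$ is any path in $\mathbb C\setminus 2\pi\mathrm i\mathbb Z$ from a point of the half-plane $\operatorname{Re}y>0$ to $y$, then the principal-value product converges and the identity holds at $y$ when $\operatorname{Li}_2(e^{-y})$, $(1-e^{-y})^{1/2}$ and all $x_n^{x_n-1/2}$ are replaced by the values at $y$ of the analytic continuations along $\gamma$ of their principal branches in the half-plane $\operatorname{Re}y>0$. (3) For every $y$ with $y\notin 2\pi\mathrm i\mathbb Z$ and $y+\beta\notin 2\pi\mathrm i\mathbb Z$, $$\prod_{n\in\mathbb Z}e^{-1}\left(1+\frac{\beta}{y+2\pi\mathrm i n}\right)^{\frac{y+2\pi\mathrm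 i n}{\beta}+\frac12}=\frac{\exp\left(\frac{\operatorname{Li}_2(e^{-y-\beta})-\operatorname{Li}_2(e^{-y})}{\beta}\right)}{(1-e^{-y})^{1/2}(1-e^{-y-\beta})^{1/2}},$$ where the product converges unconditionally (no principal value is needed) and the branch of the power is $\exp\big((x_n+\tfrac12)(\log(y+\beta+2\pi\mathrm i n)-\log(y+2\pi\mathrm i n))\big)$, which is the principal power if $\operatorname{Re}y>0$. More generally, for any path $\gamma$ from a point of the half-plane $\operatorname{Re}y>0$ to $y$ that avoids $2\pi\mathrm i\mathbb Z$ and $-\beta+2\pi\mathrm i\mathbb Z$, the same holds, with unconditional convergence, when the two dilogarithms, the two square roots and all the powers are replaced by the values at $y$ of the analytic continuations along $\gamma$ of their principal branches in $\operatorname{Re}y>0$. -/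

import Mathlib

open Filter Topology

noncomputable section

/-- The infinite `q`-Pochhammer symbol `(z; q)_∞ = ∏_{j ≥ 0} (1 - z q ^ j)` (used for `‖q‖ < 1`). -/
def qPochhammerInf (z q : ℂ) : ℂ := ∏' j : ℕ, (1 - z * q ^ j)

/-- The principal branch of the dilogarithm, `Li₂(z) = -∫₀¹ log (1 - z u) / u du`. It equals
`∑_{n ≥ 1} z ^ n / n ^ 2` for `‖z‖ ≤ 1` and is analytic off the cut `[1, ∞)`; on the cut its
value is the limit from `Im z < 0`, because `Complex.log` takes arguments in `(-π, π]`. -/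
def dilog (z : ℂ) : ℂ := -∫ u in (0 : ℝ)..1, Complex.log (1 - z * (u : ℂ)) / (u : ℂ)

/-- The point `y + 2 π i n`. -/
def shiftPt (y : ℂ) (n : ℤ) : ℂ := y + 2 * (Real.pi : ℂ) * Complex.I * (n : ℂ)

/-- The branch `exp (s * (log w - log c))` of the power `(w / c) ^ s`, with principal logarithms.
For fixed `c` its only cut in the variable `w` is the negative real axis, and it is the principal
power whenever `w` and `c` both have positive real part. -/
def quotPow (w c s : ℂ) : ℂ := Complex.exp (s * (Complex.log w - Complex.log c))

/-- `F t`, `t ∈ [0, 1]`, is an analytic continuation of (the germ at `a` of) `f` along the path `γ`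
from `a` to `b`: each `F t` is analytic at `γ t`, it starts at `f`, and for `s` close to `t`
the functions `F s` and `F t` have the same germ at `γ s`. -/
def IsAnalyticContinuationAlong {a b : ℂ} (γ : Path a b) (f : ℂ → ℂ)
    (F : unitInterval → ℂ → ℂ) : Prop :=
  F 0 =ᶠ[𝓝 a] f ∧ (∀ t, AnalyticAt ℂ (F t) (γ t)) ∧
    ∀ t, ∀ᶠ s in 𝓝 t, F s =ᶠ[𝓝 (γ s)] F t

/-- `v` is the value at the end point `b` of the analytic continuation of `f` along `γ`. -/
def ContinuesTo {a b : ℂ} (γ : Path a b) (f : ℂ → ℂ) (v : ℂ) : Prop :=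
  ∃ F : unitInterval → ℂ → ℂ, IsAnalyticContinuationAlong γ f F ∧ F 1 b = v

end

/-! Write `w_n = w + 2πin` and `L(w) = log (1 - e^{-w})`. All branches have their cuts on the
horizontal rays from the points `2πin` to the left. On a disc around 0 containing `2πin` exactly for
`|n| ≤ N`, integrating the partial fractions of `coth` gives `L = q + ∑ log w_n` and `Li₂(e^{-w}) =
A + ∑ (w_n log w_n - w_n)`, sums over `|n| ≤ N`, with `A' = q` and `q` holomorphic
(`exists_regularised_log_dilog`). All multivaluedness thus sits in finitely many logarithms.

Unconditional product: the logarithm of the `n`-th factor is the mean of `log` over the segment from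
`y_n` to `y_n + β` minus the average of its two end values, a trapezoidal error of size `O(n⁻²)`.
Summed over `n`, it becomes the same error for `L`, whose primitive is `Li₂(e^{-w})`
(`hasSum_logFactor`).

Gamma product, `Re y > 0`: by Stirling's formula the `n`-th factor is `exp` of minus the sum over `m
≥ 0` of these errors at `y + mβ`. The double sum over `(n, m)` is made absolutely convergent by
subtracting the telescoping term `(β/w - β/(w + β))/12`, and is then summed in both orders. For
fixed `n` the corrections collapse to `β/(12 y_n)`, which is why a principal value is needed; for
fixed `m` the previous formula and the `coth` series apply, and telescoping in `m` produces the
`q`-product. The equation `Γ(x+1) = xΓ(x)` then carries the formula from `y + β` back to `y`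
(`hasProd_gammaFactor`).

Paths: along a path in the disc, `log w_n` ends at its principal value plus a number `κ_n`, zero for
`|n| > N`. The resulting changes of the dilogarithm, the square root and the powers cancel. -/

/-! ### The dilogarithm of `e^{-w}` along horizontal lines -/

section Dilog

open Complex MeasureTheory Set

/-- The horizontal derivative of the principal logarithm exists everywhere off zero, also on the
branch cut. -/
theorem hasDerivAt_log_add_ofReal {z : ℂ} (hz : z ≠ 0) :
    HasDerivAt (fun x : ℝ => log (z + x)) z⁻¹ 0 := by
  by_cases h : z ∈ slitPlane
  · have h1 : HasDerivAt (fun x : ℝ => z + (x : ℂ)) 1 0 := by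
      simpa using (ofRealCLM.hasDerivAt (x := (0 : ℝ))).const_add z
    have := h1.clog_real (by simpa using h)
    simpa using this
  · have h' : z.re < 0 ∧ z.im = 0 := by
      rw [mem_slitPlane_iff] at h
      push Not at h
      refine ⟨lt_of_le_of_ne h.1 fun h0 => hz (Complex.ext h0 h.2), h.2⟩
    -- On the cut, `log (z + x) = log (-(z + x)) + πi` for small real `x`, and the logarithm on the
    -- right is away from its own cut.
    have h1 : HasDerivAt (fun x : ℝ => -z + -(x : ℂ)) (-1) 0 := by
      simpa using ((ofRealCLM.hasDerivAt (x := (0 : ℝ))).neg).const_add (-z)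
    have h2 := h1.clog_real (by simp [mem_slitPlane_iff, h'.1])
    have h3 := h2.add_const (Real.pi * I)
    have h4 : (fun x : ℝ => log (z + x)) =ᶠ[𝓝 0]
        fun x : ℝ => log (-z + -(x : ℂ)) + Real.pi * I := by
      have : ∀ᶠ x : ℝ in 𝓝 0, x < -z.re := gt_mem_nhds (by linarith [h'.1])
      filter_upwards [this] with x hx
      have e : z + (x : ℂ) = ((z.re + x : ℝ) : ℂ) := by
        apply Complex.ext <;> simp [h'.2]
      have e' : -z + -(x : ℂ) = ((-(z.re + x) : ℝ) : ℂ) := by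
        apply Complex.ext <;> simp [h'.2]; ring
      rw [e, e', ← ofReal_log (x := -(z.re + x)) (by linarith)]
      apply Complex.ext
      · rw [log_re, Complex.norm_real, Real.norm_eq_abs, Real.log_abs, ← Real.log_neg_eq_log]
        simp
      · rw [log_im, arg_ofReal_of_neg (by linarith)]
        simp
    refine (h3.congr_of_eventuallyEq h4).congr_deriv ?_
    simp [neg_inv.symm, div_eq_mul_inv]

theorem continuousAt_log_add_ofReal {z : ℂ} (hz : z ≠ 0) :
    ContinuousAt (fun x : ℝ => log (z + x)) 0 :=
  (hasDerivAt_log_add_ofReal hz).continuousAt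

/-- Scaling moves the modulus of the argument into the upper limit. Along a horizontal line `e^{-w}`
keeps its direction, so there the dilogarithm becomes a primitive of one fixed integrand. -/
theorem dilog_mul_ofReal (c : ℂ) {r : ℝ} (hr : 0 < r) :
    dilog (c * r) = -∫ v in (0 : ℝ)..r, log (1 - c * v) / v := by
  unfold dilog
  congr 1
  have := intervalIntegral.smul_integral_comp_mul_left
    (a := 0) (b := 1) (fun v : ℝ => log (1 - c * v) / v) r
  simp only [mul_zero, mul_one] at this
  rw [← this, ← intervalIntegral.integral_smul]
  refine intervalIntegral.integral_congr fun u _ => ?_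
  have : (r : ℂ) ≠ 0 := by exact_mod_cast hr.ne'
  simp only [ofReal_mul, real_smul]
  rw [mul_assoc]
  by_cases hu : (u : ℂ) = 0
  · simp [hu]
  · field_simp

theorem measurable_log_one_sub_mul_div (c : ℂ) :
    Measurable fun v : ℝ => log (1 - c * v) / (v : ℂ) := by
  have h : Measurable fun v : ℝ => (v : ℂ) := measurable_ofReal
  exact (Complex.measurable_log.comp (measurable_const.sub (measurable_const.mul h))).div h

theorem norm_log_one_sub_mul_le {c : ℂ} (hc : ‖c‖ = 1) {v : ℝ} (hv : 0 ≤ v) (hv1 : v ≠ 1) :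
    ‖log (1 - c * v)‖ ≤ |Real.log (1 - v)| + v + Real.pi := by
  have h1 : |1 - v| ≤ ‖1 - c * v‖ := by
    have := abs_norm_sub_norm_le (1 : ℂ) (c * v)
    simpa [hc, abs_of_nonneg hv] using this
  have h2 : ‖1 - c * v‖ ≤ 1 + v := by
    have := norm_sub_le (1 : ℂ) (c * v)
    simpa [hc, abs_of_nonneg hv] using this
  have h0 : 0 < |1 - v| := abs_pos.2 (sub_ne_zero.2 hv1.symm)
  have h3 : |Real.log ‖1 - c * v‖| ≤ |Real.log (1 - v)| + v := by
    rcases le_total 1 ‖1 - c * v‖ with h | h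
    · rw [abs_of_nonneg (Real.log_nonneg h)]
      have := Real.log_le_sub_one_of_pos (lt_of_lt_of_le zero_lt_one h)
      linarith [abs_nonneg (Real.log (1 - v))]
    · rw [abs_of_nonpos (Real.log_nonpos (norm_nonneg _) h)]
      have := Real.log_le_log h0 h1
      rw [Real.log_abs] at this
      linarith [neg_le_abs (Real.log (1 - v))]
  have h4 := Complex.norm_le_abs_re_add_abs_im (log (1 - c * v))
  rw [log_re, log_im] at h4
  linarith [abs_arg_le_pi (1 - c * v)]

theorem intervalIntegrable_log_one_sub_mul_div {c : ℂ} (hc : ‖c‖ = 1) {r : ℝ} (hr : 0 < r) :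
    IntervalIntegrable (fun v : ℝ => log (1 - c * v) / (v : ℂ)) volume 0 r := by
  have hm : ∀ μ : Measure ℝ, AEStronglyMeasurable (fun v : ℝ => log (1 - c * v) / (v : ℂ)) μ :=
    fun μ => (measurable_log_one_sub_mul_div c).aestronglyMeasurable
  -- One majorant for two ranges: for `v ≤ 1/2` the quotient is at most `3/2`, and for `v ≥ 1/2`
  -- division by `v` costs a factor 2.
  have key : IntervalIntegrable
      (fun v : ℝ => 2 + 2 * (|Real.log (1 - v)| + v + Real.pi)) volume 0 r := by
    have h1 : IntervalIntegrable (fun v : ℝ => Real.log (1 - v)) volume 0 r := by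
      have := (intervalIntegral.intervalIntegrable_log' (a := 1) (b := 1 - r)).comp_sub_left 1
      simpa using this
    exact intervalIntegrable_const.add (((h1.abs.add
      (continuous_id.intervalIntegrable _ _)).add intervalIntegrable_const).const_mul 2)
  refine key.mono_fun (hm _) ?_
  have hne : ∀ᵐ v : ℝ, v ≠ 1 := by
    simp [ae_iff]
  rw [Filter.EventuallyLE, uIoc_of_le hr.le, ae_restrict_iff' measurableSet_Ioc]
  filter_upwards [hne] with v hv1 hv
  have hpos : 0 ≤ |Real.log (1 - v)| + v + Real.pi := by
    have := abs_nonneg (Real.log (1 - v)); have := Real.pi_pos; linarith [hv.1]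
  rw [norm_div, Complex.norm_real, Real.norm_of_nonneg hv.1.le,
    Real.norm_of_nonneg (by linarith), div_le_iff₀ hv.1]
  rcases le_total v (1 / 2) with h | h
  · have h5 : ‖-(c * v)‖ = v := by simp [hc, abs_of_pos hv.1]
    have := Complex.norm_log_one_add_half_le_self (z := -(c * v)) (by rw [h5]; exact h)
    rw [h5, ← sub_eq_add_neg] at this
    nlinarith [mul_nonneg hpos hv.1.le, hv.1]
  · have := norm_log_one_sub_mul_le hc hv.1.le hv1
    nlinarith

theorem continuousAt_log_one_sub_mul_div {c : ℂ} (hc : ‖c‖ = 1) {r : ℝ} (hr : 0 < r)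
    (h1 : c * r ≠ 1) : ContinuousAt (fun v : ℝ => log (1 - c * v) / (v : ℂ)) r := by
  have hr' : (r : ℂ) ≠ 0 := by exact_mod_cast hr.ne'
  refine ContinuousAt.div ?_ continuous_ofReal.continuousAt hr'
  by_cases h : 1 - c * r ∈ slitPlane
  · exact ContinuousAt.clog (by fun_prop) h
  -- Here `1 - c * r` is real and nonpositive, so the unit number `c` is positive. The argument then
  -- moves along the real axis, where `log` is continuous off 0.
  · have hc1 : c = 1 := by
      rw [mem_slitPlane_iff] at h
      push Not at h
      simp only [sub_re, one_re, mul_re, ofReal_re, ofReal_im, mul_zero, sub_zero, sub_im, one_im,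
        mul_im, zero_add, zero_sub, neg_eq_zero] at h
      have him : c.im = 0 := by
        rcases mul_eq_zero.1 h.2 with h | h
        · exact h
        · exact absurd h hr.ne'
      have hre : 0 < c.re := by
        by_contra hcon
        nlinarith [h.1]
      have : c = (c.re : ℂ) := Complex.ext (by simp) (by simp [him])
      rw [this] at hc
      rw [Complex.norm_real, Real.norm_of_nonneg hre.le] at hc
      rw [this, hc]; simp
    subst hc1
    have hz : (1 - (r : ℂ)) ≠ 0 := sub_ne_zero.2 (by simpa using h1.symm)
    have h2 : ContinuousAt (fun x : ℝ => r - x) r := by fun_prop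
    have h3 := ContinuousAt.comp (f := fun x : ℝ => r - x) (x := r)
      (by simpa using continuousAt_log_add_ofReal hz) h2
    refine h3.congr (Eventually.of_forall fun v => ?_)
    simp

/-- The function `w ↦ Li₂(e^{-w})`, with the principal dilogarithm. -/
noncomputable def dilogExp (w : ℂ) : ℂ := dilog (exp (-w))

/-- The function `w ↦ log (1 - e^{-w})`, with the principal logarithm. -/
noncomputable def logOneSubExp (w : ℂ) : ℂ := log (1 - exp (-w))

theorem exp_neg_add_ofReal (w : ℂ) (x : ℝ) :
    exp (-(w + x)) = exp (-(w.im * I)) * (Real.exp (-(w.re + x)) : ℝ) := by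
  rw [ofReal_exp, ← Complex.exp_add]
  congr 1
  conv_lhs => rw [← re_add_im w]
  push_cast
  ring

theorem norm_exp_neg_ofReal_mul_I (t : ℝ) : ‖exp (-(t * I))‖ = 1 := by
  rw [← neg_mul, ← ofReal_neg, norm_exp_ofReal_mul_I]

theorem dilogExp_add_ofReal (w : ℂ) (x : ℝ) : dilogExp (w + x) =
    -∫ v in (0 : ℝ)..Real.exp (-(w.re + x)), log (1 - exp (-(w.im * I)) * v) / v := by
  rw [dilogExp, exp_neg_add_ofReal, dilog_mul_ofReal _ (Real.exp_pos _)]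

/-- The horizontal derivative of `Li₂(e^{-w})`, also on the branch cuts. -/
theorem hasDerivAt_dilogExp_add_ofReal {w : ℂ} (hw : exp (-w) ≠ 1) :
    HasDerivAt (fun x : ℝ => dilogExp (w + x)) (logOneSubExp w) 0 := by
  simp_rw [dilogExp_add_ofReal]
  set c := exp (-(w.im * I)) with hc
  have hc1 : ‖c‖ = 1 := norm_exp_neg_ofReal_mul_I _
  have hcr : c * (Real.exp (-(w.re + 0)) : ℝ) = exp (-w) := by
    rw [← exp_neg_add_ofReal]; simp
  have hr := Real.exp_pos (-(w.re + 0))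
  have h1 := intervalIntegral.integral_hasDerivAt_right
    (intervalIntegrable_log_one_sub_mul_div hc1 hr)
    (measurable_log_one_sub_mul_div c).stronglyMeasurable.stronglyMeasurableAtFilter
    (continuousAt_log_one_sub_mul_div hc1 hr (by rw [hcr]; exact hw))
  have h2 : HasDerivAt (fun x : ℝ => Real.exp (-(w.re + x)))
      (Real.exp (-(w.re + 0)) * (-1)) 0 := by
    have : HasDerivAt (fun x : ℝ => -(w.re + x)) (-1) 0 :=
      ((hasDerivAt_id (0 : ℝ)).const_add w.re).neg
    exact this.exp
  have h3 := (h1.scomp (0 : ℝ) h2).neg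
  refine h3.congr_deriv ?_
  rw [hcr, logOneSubExp]
  have : ((Real.exp (-(w.re + 0)) : ℝ) : ℂ) ≠ 0 := by exact_mod_cast hr.ne'
  simp only [real_smul, ofReal_mul, ofReal_neg, ofReal_one]
  field_simp

/-- A primitive of an integrable function is continuous even across the logarithmic singularity, so
the points `2πin` need not be excluded. -/
theorem continuousAt_dilogExp_add_ofReal (w : ℂ) :
    ContinuousAt (fun x : ℝ => dilogExp (w + x)) 0 := by
  simp_rw [dilogExp_add_ofReal]
  have hc1 : ‖exp (-(w.im * I))‖ = 1 := norm_exp_neg_ofReal_mul_I _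
  refine ContinuousAt.neg ?_
  have hR : 0 < Real.exp (-w.re) + 1 := by positivity
  have h := intervalIntegral.continuousOn_primitive_interval'
    (intervalIntegrable_log_one_sub_mul_div hc1 hR) (left_mem_uIcc)
  have h' : ContinuousAt (fun b => ∫ v in (0 : ℝ)..b, log (1 - exp (-(w.im * I)) * v) / v)
      (Real.exp (-(w.re + 0))) := by
    refine h.continuousAt ?_
    rw [uIcc_of_le hR.le]
    refine Icc_mem_nhds (Real.exp_pos _) (by simp)
  exact ContinuousAt.comp (f := fun x : ℝ => Real.exp (-(w.re + x))) (x := 0) h' (by fun_prop)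

theorem dilog_zero : dilog 0 = 0 := by
  simp [dilog]

/-- Differentiation under the integral sign. The derivative stays an integral so that one formula
covers `z = 0`, where `-log (1 - z) / z` would read `0 / 0`. -/
theorem hasDerivAt_dilog {z : ℂ} (hz : ‖z‖ < 1) :
    HasDerivAt dilog (∫ u in (0 : ℝ)..1, (1 - z * u)⁻¹) z := by
  obtain ⟨ρ, hρ1, hρ⟩ := exists_between hz
  have hslit : ∀ x ∈ Metric.ball (0 : ℂ) ρ, ∀ u ∈ Icc (0 : ℝ) 1, 1 - ρ ≤ (1 - x * u).re := by
    intro x hx u hu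
    rw [mem_ball_zero_iff] at hx
    have h1 : (x * u).re ≤ ‖x * u‖ := re_le_norm _
    have h2 : ‖x * u‖ ≤ ρ := by
      rw [norm_mul, Complex.norm_real, Real.norm_of_nonneg hu.1]
      nlinarith [norm_nonneg x, hu.1, hu.2]
    simp only [sub_re, one_re]
    linarith
  have hmem : Metric.ball (0 : ℂ) ρ ∈ 𝓝 z := Metric.isOpen_ball.mem_nhds (by simpa using hρ1)
  have hd : ∀ u ∈ Ioc (0 : ℝ) 1, ∀ x ∈ Metric.ball (0 : ℂ) ρ,
      HasDerivAt (fun x : ℂ => -(log (1 - x * u) / u)) ((1 - x * u)⁻¹) x := by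
    intro u hu x hx
    have h1 : HasDerivAt (fun x : ℂ => 1 - x * (u : ℂ)) (-(u : ℂ)) x := by
      simpa using ((hasDerivAt_id x).mul_const (u : ℂ)).const_sub 1
    have hs := hslit x hx u ⟨hu.1.le, hu.2⟩
    have hs' : 1 - x * (u : ℂ) ∈ slitPlane := Or.inl (by linarith)
    have hu' : (u : ℂ) ≠ 0 := by exact_mod_cast hu.1.ne'
    refine ((h1.clog hs').div_const (u : ℂ)).neg.congr_deriv ?_
    have := slitPlane_ne_zero hs'
    field_simp
  have hmeas : ∀ x : ℂ, AEStronglyMeasurable (fun u : ℝ => -(log (1 - x * u) / (u : ℂ)))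
      (volume.restrict (uIoc (0 : ℝ) 1)) :=
    fun x => (measurable_log_one_sub_mul_div x).neg.aestronglyMeasurable
  have hcont : ContinuousOn (fun u : ℝ => (1 - z * (u : ℂ))⁻¹) (uIcc 0 1) := by
    rw [uIcc_of_le zero_le_one]
    refine ContinuousOn.inv₀ (by fun_prop) fun u hu h0 => ?_
    have := hslit z (by simpa using hρ1) u hu
    rw [h0] at this
    simp at this; linarith
  have hint : IntervalIntegrable (fun u : ℝ => -(log (1 - z * u) / (u : ℂ))) volume 0 1 := by
    refine (intervalIntegrable_const (c := (1 - ρ)⁻¹ * 2)).mono_fun (hmeas z) ?_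
    rw [Filter.EventuallyLE, uIoc_of_le zero_le_one, ae_restrict_iff' measurableSet_Ioc]
    refine Eventually.of_forall fun u hu => ?_
    have hρ0 : 0 ≤ ρ := (norm_nonneg z).trans hρ1.le
    have h5 : ‖-(z * u)‖ ≤ ρ * u := by
      rw [norm_neg, norm_mul, Complex.norm_real, Real.norm_of_nonneg hu.1.le]
      nlinarith [hu.1]
    have h6 : ‖-(z * u)‖ ≤ ρ := h5.trans (by nlinarith [hu.2])
    have h7 := Complex.norm_log_one_add_le (z := -(z * u)) (by linarith)
    rw [← sub_eq_add_neg] at h7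
    have hpos : 0 < 1 - ρ := by linarith
    have h8 : (1 - ‖-(z * u)‖)⁻¹ ≤ (1 - ρ)⁻¹ := inv_anti₀ hpos (by linarith)
    have h9 : 0 < (1 - ρ)⁻¹ := by positivity
    have h9' : 1 ≤ (1 - ρ)⁻¹ := (one_le_inv₀ hpos).2 (by linarith)
    rw [norm_neg, norm_div, Complex.norm_real, Real.norm_of_nonneg hu.1.le, norm_mul, norm_inv,
      Real.norm_of_nonneg hpos.le, div_le_iff₀ hu.1]
    have hu1 : u ≤ 1 := hu.2
    have h10 : ‖-(z * u)‖ ≤ u := h5.trans (by nlinarith [hu.1])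
    have h11 : ‖-(z * u)‖ ^ 2 ≤ u := by nlinarith [norm_nonneg (-(z * u)), hu.1]
    have h12 : ‖-(z * u)‖ ^ 2 * (1 - ‖-(z * u)‖)⁻¹ ≤ u * (1 - ρ)⁻¹ := by
      exact mul_le_mul h11 h8 (inv_nonneg.2 (by linarith)) hu.1.le
    simp only [Real.norm_ofNat]
    nlinarith [hu.1]
  have h := (intervalIntegral.hasDerivAt_integral_of_dominated_loc_of_deriv_le (μ := volume)
    (F := fun x u => -(log (1 - x * u) / (u : ℂ)))
    (F' := fun x (u : ℝ) => (1 - x * (u : ℂ))⁻¹) (a := 0) (b := 1) (bound := fun _ => (1 - ρ)⁻¹)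
    hmem (Eventually.of_forall hmeas) hint
    (by
      rw [uIoc_of_le zero_le_one]
      exact (hcont.mono (by rw [uIcc_of_le zero_le_one]; exact Ioc_subset_Icc_self)
        ).aestronglyMeasurable measurableSet_Ioc)
    (Eventually.of_forall fun u hu x hx => by
      rw [uIoc_of_le zero_le_one] at hu
      have hs := hslit x hx u ⟨hu.1.le, hu.2⟩
      rw [norm_inv]
      exact inv_anti₀ (by linarith) (hs.trans (re_le_norm _)))
    intervalIntegrable_const
    (Eventually.of_forall fun u hu x hx => by
      rw [uIoc_of_le zero_le_one] at hu
      exact hd u hu x hx)).2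
  refine h.congr_of_eventuallyEq (Eventually.of_forall fun x => ?_)
  simp [dilog]

theorem integral_inv_one_sub_mul {z : ℂ} (hz : ‖z‖ < 1) :
    z * ∫ u in (0 : ℝ)..1, (1 - z * u)⁻¹ = -log (1 - z) := by
  have hslit : ∀ u ∈ Icc (0 : ℝ) 1, 1 - z * u ∈ slitPlane := by
    intro u hu
    have h1 : (z * u).re ≤ ‖z * u‖ := re_le_norm _
    have h2 : ‖z * u‖ < 1 := by
      rw [norm_mul, Complex.norm_real, Real.norm_of_nonneg hu.1]
      nlinarith [norm_nonneg z, hu.1, hu.2]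
    left
    simp only [sub_re, one_re]
    linarith
  rw [← intervalIntegral.integral_const_mul]
  have hI : uIcc (0 : ℝ) 1 = Icc 0 1 := uIcc_of_le zero_le_one
  have := intervalIntegral.integral_eq_sub_of_hasDerivAt (a := 0) (b := 1)
    (f := fun u : ℝ => -log (1 - z * u)) (f' := fun u : ℝ => z * (1 - z * u)⁻¹)
    (fun u hu => by
      rw [hI] at hu
      have h1 : HasDerivAt (fun u : ℝ => 1 - z * (u : ℂ)) (-z) u := by
        simpa using ((ofRealCLM.hasDerivAt (x := u)).const_mul z).const_sub 1
      refine (h1.clog_real (hslit u hu)).neg.congr_deriv ?_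
      rw [div_eq_mul_inv]; ring)
    (ContinuousOn.intervalIntegrable (by
      rw [hI]
      exact continuousOn_const.mul (ContinuousOn.inv₀ (by fun_prop)
        fun u hu => slitPlane_ne_zero (hslit u hu))))
  rw [this]
  simp

theorem norm_exp_neg_lt_one {w : ℂ} (hw : 0 < w.re) : ‖exp (-w)‖ < 1 := by
  rw [Complex.norm_exp]; simpa using hw

theorem hasDerivAt_dilogExp {w : ℂ} (hw : 0 < w.re) :
    HasDerivAt dilogExp (logOneSubExp w) w := by
  have h1 := norm_exp_neg_lt_one hw
  have h2 : HasDerivAt (fun w : ℂ => exp (-w)) (exp (-w) * -1) w := (hasDerivAt_neg w).cexp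
  refine ((hasDerivAt_dilog h1).comp w h2).congr_deriv ?_
  rw [logOneSubExp, ← neg_eq_iff_eq_neg.2 (integral_inv_one_sub_mul h1)]
  ring

theorem one_sub_exp_neg_mem_slitPlane {w : ℂ} (hw : 0 < w.re) : 1 - exp (-w) ∈ slitPlane := by
  left
  have := (re_le_norm (exp (-w))).trans_lt (norm_exp_neg_lt_one hw)
  simpa using this

theorem tendsto_dilog_zero : Tendsto dilog (𝓝 0) (𝓝 0) := by
  have := (hasDerivAt_dilog (z := 0) (by simp)).continuousAt.tendsto
  rwa [dilog_zero] at this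

end Dilog

/-! ### Partial fractions of the hyperbolic cotangent -/

section Cotangent

open Complex Set

theorem shiftPt_re (w : ℂ) (n : ℤ) : (shiftPt w n).re = w.re := by
  simp [shiftPt]

theorem shiftPt_im (w : ℂ) (n : ℤ) : (shiftPt w n).im = w.im + 2 * Real.pi * n := by
  simp [shiftPt]

theorem shiftPt_add (w z : ℂ) (n : ℤ) : shiftPt (w + z) n = shiftPt w n + z := by
  simp only [shiftPt]; ring

theorem hasDerivAt_shiftPt (w : ℂ) (n : ℤ) : HasDerivAt (fun w => shiftPt w n) 1 w :=
  (hasDerivAt_id w).add_const _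

theorem exp_neg_ne_one_iff {w : ℂ} : exp (-w) ≠ 1 ↔ ∀ n : ℤ, shiftPt w n ≠ 0 := by
  rw [ne_eq, Complex.exp_eq_one_iff, not_exists]
  refine forall_congr' fun n => not_congr ?_
  simp only [shiftPt]
  constructor <;> intro h
  · linear_combination -h
  · linear_combination -h

theorem one_sub_exp_neg_ne_zero {w : ℂ} (hw : ∀ n : ℤ, shiftPt w n ≠ 0) : 1 - exp (-w) ≠ 0 :=
  sub_ne_zero.2 (exp_neg_ne_one_iff.2 hw).symm

theorem shiftPt_ne_zero_of_re_ne_zero {w : ℂ} (hw : w.re ≠ 0) (n : ℤ) : shiftPt w n ≠ 0 :=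
  fun h => hw (by rw [← shiftPt_re w n, h, zero_re])

theorem HasSum.symmetricIcc {f : ℤ → ℂ} {a : ℂ} (h : HasSum f a) :
    HasSum f a (SummationFilter.symmetricIcc ℤ) :=
  h.mono_left (SummationFilter.LeAtTop.le_atTop)

theorem HasProd.symmetricIcc {f : ℤ → ℂ} {a : ℂ} (h : HasProd f a) :
    HasProd f a (SummationFilter.symmetricIcc ℤ) :=
  h.mono_left (SummationFilter.LeAtTop.le_atTop)

theorem sum_Icc_eq_zero_of_odd {f : ℤ → ℂ} (hf : ∀ n, f (-n) = -f n) (N : ℕ) :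
    ∑ n ∈ Finset.Icc (-(N : ℤ)) N, f n = 0 := by
  have h := Finset.sum_nbij' (s := Finset.Icc (-(N : ℤ)) N) (t := Finset.Icc (-(N : ℤ)) N)
    (f := f) (g := fun n : ℤ => -f n) (fun n => -n) (fun n => -n)
    (fun n hn => by rw [Finset.mem_Icc] at *; omega)
    (fun n hn => by rw [Finset.mem_Icc] at *; omega)
    (fun n _ => neg_neg n) (fun n _ => neg_neg n) (fun n _ => by rw [hf, neg_neg])
  rw [Finset.sum_neg_distrib] at h
  exact self_eq_neg.1 h

theorem hasSum_symmetricIcc_zero_of_odd {f : ℤ → ℂ} (hf : ∀ n, f (-n) = -f n) :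
    HasSum f 0 (SummationFilter.symmetricIcc ℤ) := by
  rw [SummationFilter.hasSum_symmetricIcc_iff]
  exact tendsto_const_nhds.congr fun N => (sum_Icc_eq_zero_of_odd hf N).symm

/-- The partial fraction expansion of the hyperbolic cotangent. -/
theorem hasSum_inv_shiftPt {w : ℂ} (hw : ∀ n : ℤ, shiftPt w n ≠ 0) :
    HasSum (fun n : ℤ => 1 / shiftPt w n) (cosh (w / 2) / sinh (w / 2) / 2)
      (SummationFilter.symmetricIcc ℤ) := by
  have hpi : (Real.pi : ℂ) ≠ 0 := by exact_mod_cast Real.pi_ne_zero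
  have hI := I_ne_zero
  set x : ℂ := w / (2 * Real.pi * I) with hx
  have hxs : ∀ n : ℤ, shiftPt w n = 2 * Real.pi * I * (x + n) := by
    intro n; rw [shiftPt, hx]; field_simp
  have hxi : x ∈ integerComplement := by
    rw [mem_integerComplement_iff]
    rintro ⟨n, hn⟩
    refine hw (-n) ?_
    rw [hxs, ← hn]; simp
  have h1 := (summable_cotTerm hxi).hasSum
  have h2 : ∑' n, cotTerm x n = Real.pi * cot (Real.pi * x) - 1 / x := by
    rw [cot_series_rep' hxi]
  rw [h2] at h1
  have h3 := h1.tendsto_sum_nat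
  have h4 := ((h3.add_const (1 / x)).const_mul (1 / (2 * Real.pi * I)))
  rw [SummationFilter.hasSum_symmetricIcc_iff]
  have e : 1 / (2 * Real.pi * I) * (Real.pi * cot (Real.pi * x) - 1 / x + 1 / x)
      = cosh (w / 2) / sinh (w / 2) / 2 := by
    have : (Real.pi : ℂ) * x = -(w / 2 * I) := by
      rw [hx]; field_simp; simp
    rw [sub_add_cancel, this, cot, Complex.cos_neg, Complex.sin_neg, Complex.cos_mul_I,
      Complex.sin_mul_I]
    have hs : sinh (w / 2) ≠ 0 := by
      intro h
      have h' : Complex.sin (Real.pi * x) = 0 := by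
        rw [this, Complex.sin_neg, Complex.sin_mul_I, h]; simp
      exact sin_pi_mul_ne_zero hxi h'
    field_simp
    linear_combination -cosh (w / 2) * I_sq
  rw [e] at h4
  refine h4.congr fun N => ?_
  induction N with
  | zero => simp [hxs, mul_comm]
  | succ N ih =>
    rw [Nat.cast_succ, Finset.sum_Icc_succ_eq_add_endpoints, ← ih, Finset.sum_range_succ, hxs, hxs, cotTerm]
    have a1 : x + ((N : ℂ) + 1) ≠ 0 := by
      simpa using integerComplement_add_ne_zero hxi ((N : ℤ) + 1)
    have a2 : x - ((N : ℂ) + 1) ≠ 0 := by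
      simpa [sub_eq_add_neg] using integerComplement_add_ne_zero hxi (-((N : ℤ) + 1))
    have a3 : x + -((N : ℂ) + 1) ≠ 0 := by rwa [← sub_eq_add_neg]
    have a4 : x ≠ 0 := integerComplement.ne_zero hxi
    push_cast
    rw [← sub_eq_add_neg]
    field_simp
    ring

/-- The first term on the right is the derivative of `log (1 - e^{-w})`; this is the source of the
`- 1 / 2` in the derivative of the regularised logarithm. -/
theorem coth_half_eq {w : ℂ} (hw : 1 - exp (-w) ≠ 0) :
    cosh (w / 2) / sinh (w / 2) / 2 = exp (-w) / (1 - exp (-w)) + 1 / 2 := by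
  have e : exp (-w) = exp (-(w / 2)) * exp (-(w / 2)) := by rw [← Complex.exp_add]; congr 1; ring
  have e2 : exp (w / 2) = (exp (-(w / 2)))⁻¹ := by rw [Complex.exp_neg, inv_inv]
  have h0 := Complex.exp_ne_zero (-(w / 2))
  rw [cosh, sinh, e2]
  rw [e] at hw ⊢
  set u := exp (-(w / 2))
  have h3 : u⁻¹ - u ≠ 0 := by
    intro h; apply hw; field_simp at h; linear_combination h
  have h4 : 1 - u ^ 2 ≠ 0 := by rw [pow_two]; exact hw
  field_simp
  ring

end Cotangent

/-! ### The part of the cotangent holomorphic on a large disc -/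

section Tail

open Complex Set

/-- The radius of a disc around zero that contains `2 π i n` exactly for `|n| ≤ N`. -/
noncomputable def discRadius (N : ℕ) : ℝ := Real.pi * (2 * N + 1)

theorem one_lt_discRadius (N : ℕ) : 1 < discRadius N := by
  have := Real.pi_gt_three
  have : (0 : ℝ) ≤ N := N.cast_nonneg
  unfold discRadius; nlinarith

/-- On the disc `|Im w| < π(2N + 1)`, and `2π|n| - π(2N + 1) ≥ π|n|/(N + 1)` once `|n| ≥ N + 1`,
with equality at `|n| = N + 1`. -/
theorem im_shiftPt_bound {N : ℕ} {w : ℂ} (hw : w ∈ Metric.ball 0 (discRadius N)) {n : ℤ}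
    (hn : n ∉ Finset.Icc (-(N : ℤ)) N) :
    Real.pi * |(n : ℝ)| / (N + 1) < |(shiftPt w n).im| := by
  have h1 : |w.im| < Real.pi * (2 * N + 1) := (abs_im_le_norm w).trans_lt (by simpa [discRadius] using hw)
  have h2 : (N : ℤ) + 1 ≤ |n| := by
    by_contra h
    apply hn
    rw [Finset.mem_Icc, ← abs_le]
    omega
  have h3 : (N : ℝ) + 1 ≤ |(n : ℝ)| := by exact_mod_cast h2
  have hpi := Real.pi_pos
  have h4 : 2 * Real.pi * |(n : ℝ)| - |w.im| ≤ |(shiftPt w n).im| := by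
    rw [shiftPt_im]
    have h5 : |2 * Real.pi * (n : ℝ)| = 2 * Real.pi * |(n : ℝ)| := by
      rw [abs_mul, abs_of_pos (by positivity)]
    have := abs_sub_abs_le_abs_sub (2 * Real.pi * (n : ℝ)) (-w.im)
    rw [abs_neg, h5, sub_neg_eq_add, add_comm] at this
    linarith
  have h0 : (0 : ℝ) < N + 1 := by positivity
  refine lt_of_lt_of_le ?_ h4
  rw [div_lt_iff₀ h0]
  have hN : (0 : ℝ) ≤ N := N.cast_nonneg
  nlinarith [mul_nonneg hpi.le hN, mul_nonneg (mul_nonneg hpi.le hN) (sub_nonneg.2 h3),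
    mul_nonneg hpi.le (sub_nonneg.2 h3)]

theorem im_shiftPt_ne_zero {N : ℕ} {w : ℂ} (hw : w ∈ Metric.ball 0 (discRadius N)) {n : ℤ}
    (hn : n ∉ Finset.Icc (-(N : ℤ)) N) : (shiftPt w n).im ≠ 0 := by
  have := im_shiftPt_bound hw hn
  have h2 : 0 ≤ Real.pi * |(n : ℝ)| / (N + 1) := by positivity
  exact abs_pos.1 (h2.trans_lt this)

theorem shiftPt_ne_zero_of_notMem {N : ℕ} {w : ℂ} (hw : w ∈ Metric.ball 0 (discRadius N)) {n : ℤ}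
    (hn : n ∉ Finset.Icc (-(N : ℤ)) N) : shiftPt w n ≠ 0 :=
  fun h => im_shiftPt_ne_zero hw hn (by rw [h, zero_im])

/-- The partial fraction `1 / (w + 2 π i n)`, normalised to vanish at zero, for `|n| > N`. -/
noncomputable def cothTailTerm (N : ℕ) (n : ℤ) (w : ℂ) : ℂ :=
  if n ∈ Finset.Icc (-(N : ℤ)) N then 0 else 1 / shiftPt w n - 1 / (2 * Real.pi * I * n)

/-- The normalised partial fraction sum over the poles `2 π i n` with `|n| > N`. -/
noncomputable def cothTail (N : ℕ) (w : ℂ) : ℂ := ∑' n : ℤ, cothTailTerm N n w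

/-- The derivative of `cothTailTerm`. -/
noncomputable def derivCothTailTerm (N : ℕ) (n : ℤ) (w : ℂ) : ℂ :=
  if n ∈ Finset.Icc (-(N : ℤ)) N then 0 else -(1 / shiftPt w n ^ 2)

/-- The termwise derivative of `cothTail`. -/
noncomputable def derivCothTail (N : ℕ) (w : ℂ) : ℂ :=
  ∑' n : ℤ, derivCothTailTerm N n w

theorem norm_derivCothTailTerm_le {N : ℕ} {w : ℂ} (hw : w ∈ Metric.ball 0 (discRadius N)) (n : ℤ) :
    ‖derivCothTailTerm N n w‖ ≤ ((N + 1) / Real.pi) ^ 2 * (1 / (n : ℝ) ^ 2) := by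
  rw [derivCothTailTerm]
  split_ifs with hn
  · rw [norm_zero]; positivity
  · have h1 := (im_shiftPt_bound hw hn).trans_le (abs_im_le_norm _)
    have hn0 : (n : ℝ) ≠ 0 := by
      rintro h
      rw [Int.cast_eq_zero] at h
      subst h
      simp at hn
    have h2 : 0 < Real.pi * |(n : ℝ)| / (N + 1) := by
      have := abs_pos.2 hn0
      positivity
    rw [norm_neg, norm_div, norm_one, norm_pow]
    have h3 : (Real.pi * |(n : ℝ)| / (N + 1)) ^ 2 ≤ ‖shiftPt w n‖ ^ 2 :=
      pow_le_pow_left₀ h2.le h1.le 2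
    calc 1 / ‖shiftPt w n‖ ^ 2 ≤ 1 / (Real.pi * |(n : ℝ)| / (N + 1)) ^ 2 :=
          one_div_le_one_div_of_le (by positivity) h3
      _ = _ := by
          rw [div_pow, mul_pow, sq_abs]
          field_simp

theorem summable_const_mul_one_div_int_sq (c : ℝ) :
    Summable fun n : ℤ => c * (1 / (n : ℝ) ^ 2) :=
  (Real.summable_one_div_int_pow.2 one_lt_two).mul_left c

theorem hasDerivAt_cothTailTerm {N : ℕ} (n : ℤ) (w : ℂ)
    (hw : w ∈ Metric.ball 0 (discRadius N)) :
    HasDerivAt (cothTailTerm N n) (derivCothTailTerm N n w) w := by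
  unfold cothTailTerm derivCothTailTerm
  split_ifs with hn
  · exact hasDerivAt_const w _
  · have := ((hasDerivAt_shiftPt w n).inv (shiftPt_ne_zero_of_notMem hw hn)).sub_const
      (1 / (2 * Real.pi * I * n))
    simpa [div_eq_mul_inv] using this

theorem cothTailTerm_zero (N : ℕ) (n : ℤ) : cothTailTerm N n 0 = 0 := by
  simp [cothTailTerm, shiftPt]

theorem summable_cothTailTerm_zero (N : ℕ) : Summable fun n : ℤ => cothTailTerm N n 0 := by
  simp [cothTailTerm_zero, summable_zero]

theorem hasDerivAt_cothTail {N : ℕ} {w : ℂ} (hw : w ∈ Metric.ball 0 (discRadius N)) :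
    HasDerivAt (cothTail N) (derivCothTail N w) w :=
  hasDerivAt_tsum_of_isPreconnected (y₀ := 0) (summable_const_mul_one_div_int_sq _)
    Metric.isOpen_ball (convex_ball _ _).isPreconnected hasDerivAt_cothTailTerm
    (fun n y hy => norm_derivCothTailTerm_le hy n)
    (Metric.mem_ball_self (by have := one_lt_discRadius N; linarith))
    (summable_cothTailTerm_zero N) hw

/-- The corrections `1/(2πin)` give absolute convergence but are odd in `n`, hence invisible to
symmetric partial sums. The tail is therefore the principal value with its central terms removed. -/
theorem cothTail_eq {N : ℕ} {w : ℂ} (hw : w ∈ Metric.ball 0 (discRadius N))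
    (hw0 : ∀ n : ℤ, shiftPt w n ≠ 0) :
    cothTail N w = cosh (w / 2) / sinh (w / 2) / 2 -
      ∑ n ∈ Finset.Icc (-(N : ℤ)) N, 1 / shiftPt w n := by
  have h1 : Summable fun n : ℤ => cothTailTerm N n w :=
    summable_of_summable_hasDerivAt_of_isPreconnected (y₀ := 0)
      (summable_const_mul_one_div_int_sq _)
      Metric.isOpen_ball (convex_ball _ _).isPreconnected hasDerivAt_cothTailTerm
      (fun n y hy => norm_derivCothTailTerm_le hy n)
      (Metric.mem_ball_self (by have := one_lt_discRadius N; linarith))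
      (summable_cothTailTerm_zero N) hw
  have h2 := HasSum.symmetricIcc h1.hasSum
  -- At `n = 0` both sides are zero by the convention `1 / 0 = 0`.
  have hodd : ∀ n : ℤ, 1 / (2 * Real.pi * I * ((-n : ℤ) : ℂ)) = -(1 / (2 * Real.pi * I * n)) :=
    fun n => by push_cast; rw [mul_neg, div_neg]
  have h3 := hasSum_symmetricIcc_zero_of_odd (f := fun n : ℤ => 1 / (2 * Real.pi * I * n)) hodd
  have h0 : ∑ n ∈ Finset.Icc (-(N : ℤ)) N, 1 / (2 * Real.pi * I * (n : ℂ)) = 0 :=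
    sum_Icc_eq_zero_of_odd hodd N
  have h4 := hasSum_sum_of_ne_finset_zero (s := Finset.Icc (-(N : ℤ)) N)
    (L := SummationFilter.symmetricIcc ℤ)
    (f := fun n : ℤ => if n ∈ Finset.Icc (-(N : ℤ)) N then
      1 / shiftPt w n - 1 / (2 * Real.pi * I * n) else 0)
    (fun n hn => if_neg hn)
  have h5 := ((hasSum_inv_shiftPt hw0).sub h3).sub h4
  have e : (fun n : ℤ => 1 / shiftPt w n - 1 / (2 * Real.pi * I * n) -
      (if n ∈ Finset.Icc (-(N : ℤ)) N then 1 / shiftPt w n - 1 / (2 * Real.pi * I * n) else 0)) =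
      fun n : ℤ => cothTailTerm N n w := by
    funext n
    rw [cothTailTerm]
    split_ifs
    · exact sub_self _
    · exact sub_zero _
  rw [e] at h5
  rw [cothTail, h2.unique h5, Finset.sum_congr rfl fun n hn => if_pos hn,
    Finset.sum_sub_distrib, h0]
  ring

end Tail

/-! ### Splitting off finitely many logarithms on a disc -/

section Regularised

open Complex Set

/-- The approach is from above because on its cut `Complex.log` has argument `π`. -/
theorem tendsto_log_add_mul_I {z : ℂ} (hz : z ≠ 0) :
    Tendsto (fun t : ℝ => log (z + t * I)) (𝓝[>] 0) (𝓝 (log z)) := by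
  have h0 : Tendsto (fun t : ℝ => z + t * I) (𝓝[>] 0) (𝓝 z) := by
    have : ContinuousAt (fun t : ℝ => z + t * I) 0 := by fun_prop
    have h := this.tendsto.mono_left (nhdsWithin_le_nhds (s := Ioi 0))
    simpa using h
  by_cases h : z ∈ slitPlane
  · exact h0.clog h
  · rw [mem_slitPlane_iff] at h
    push Not at h
    have hre : z.re < 0 := lt_of_le_of_ne h.1 fun h1 => hz (Complex.ext h1 h.2)
    refine (continuousWithinAt_log_of_re_neg_of_im_zero hre h.2).tendsto.comp
      (tendsto_nhdsWithin_iff.2 ⟨h0, ?_⟩)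
    filter_upwards [self_mem_nhdsWithin] with t ht
    have : 0 < t := ht
    simp [h.2, this.le]

/-- Raising `w` slightly from a height in `2πℤ` keeps `1 - e^{-w}` in the closed upper half-plane.
This function thus takes its cut values from the same side as the logarithms of `shiftPt`. -/
theorem tendsto_logOneSubExp_add_mul_I {w : ℂ} (hw : exp (-w) ≠ 1) {k : ℤ}
    (him : (shiftPt w k).im = 0) :
    Tendsto (fun t : ℝ => logOneSubExp (w + t * I)) (𝓝[>] 0) (𝓝 (logOneSubExp w)) := by
  have h0 : Tendsto (fun t : ℝ => 1 - exp (-(w + t * I))) (𝓝[>] 0) (𝓝 (1 - exp (-w))) := by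
    have : ContinuousAt (fun t : ℝ => 1 - exp (-(w + t * I))) 0 := by fun_prop
    have h := this.tendsto.mono_left (nhdsWithin_le_nhds (s := Ioi 0))
    simpa using h
  by_cases h : 1 - exp (-w) ∈ slitPlane
  · exact h0.clog h
  · have hne : 1 - exp (-w) ≠ 0 := sub_ne_zero.2 hw.symm
    have e : exp (-w) = (Real.exp (-w.re) : ℝ) := by
      rw [shiftPt_im] at him
      have : w = w.re + 2 * Real.pi * (-k) * I := by
        apply Complex.ext
        · simp
        · simp; linarith
      rw [ofReal_exp, Complex.exp_eq_exp_iff_exists_int]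
      refine ⟨k, ?_⟩
      conv_lhs => rw [this]
      push_cast
      ring
    have hr : (1 - exp (-w)).im = 0 := by rw [e]; simp [-ofReal_exp]
    rw [mem_slitPlane_iff] at h
    push Not at h
    have hre : (1 - exp (-w)).re < 0 := lt_of_le_of_ne h.1 fun h1 => hne (Complex.ext h1 h.2)
    refine (continuousWithinAt_log_of_re_neg_of_im_zero hre hr).tendsto.comp
      (tendsto_nhdsWithin_iff.2 ⟨h0, ?_⟩)
    filter_upwards [Ioo_mem_nhdsGT Real.pi_pos] with t ht
    have e2 : exp (-(w + t * I)) = (Real.exp (-w.re) : ℝ) * exp (-(t * I)) := by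
      rw [← e, ← Complex.exp_add]; congr 1; ring
    have := mul_nonneg (Real.exp_pos (-w.re)).le (Real.sin_nonneg_of_nonneg_of_le_pi ht.1.le ht.2.le)
    change 0 ≤ (1 - exp (-(w + t * I))).im
    rw [e2, sub_im, one_im, im_ofReal_mul, Complex.exp_im]
    simpa using this

/-- On the cut `e^{-w}` is real and at least 1, hence `cos (Im w) = 1`. -/
theorem im_shiftPt_eq_zero_of_notMem_slitPlane {w : ℂ} (hw : 1 - exp (-w) ∉ slitPlane) :
    ∃ k : ℤ, (shiftPt w k).im = 0 := by
  rw [mem_slitPlane_iff] at hw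
  push Not at hw
  have e : 1 ≤ Real.exp (-w.re) * Real.cos w.im := by
    have := hw.1
    rw [sub_re, Complex.exp_re] at this
    simpa using this
  have e2 : Real.sin w.im = 0 := by
    have := hw.2
    rw [sub_im, Complex.exp_im] at this
    simpa [Real.exp_ne_zero] using this
  have e3 : Real.cos w.im = 1 := by
    rcases Real.sin_eq_zero_iff_cos_eq.1 e2 with h | h
    · exact h
    · rw [h] at e; linarith [Real.exp_pos (-w.re)]
  obtain ⟨k, hk⟩ := (Real.cos_eq_one_iff _).1 e3
  refine ⟨-k, ?_⟩
  rw [shiftPt_im]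
  push_cast
  linarith

/-- A function that vanishes on the right half of a disc and has vanishing horizontal derivative on
the left half vanishes at each point of the left half. -/
theorem eq_zero_of_horizontal_deriv_eq_zero {E : ℂ → ℂ} {ρ : ℝ} {w : ℂ}
    (hw : w ∈ Metric.ball 0 ρ) (hre : w.re ≤ 0)
    (hE : ∀ z ∈ Metric.ball (0 : ℂ) ρ, 0 < z.re → E z = 0)
    (hcont : ∀ z ∈ Metric.ball (0 : ℂ) ρ, z.im = w.im → w.re ≤ z.re →
      ContinuousAt (fun x : ℝ => E (z + x)) 0)
    (hderiv : ∀ z ∈ Metric.ball (0 : ℂ) ρ, z.im = w.im → w.re ≤ z.re → z.re < 0 →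
      HasDerivAt (fun x : ℝ => E (z + x)) 0 0) : E w = 0 := by
  have hball : ∀ x : ℝ, w.re ≤ x → x ≤ 0 → (x : ℂ) + w.im * I ∈ Metric.ball (0 : ℂ) ρ := by
    intro x h1 h2
    rw [mem_ball_zero_iff] at hw ⊢
    refine lt_of_le_of_lt ?_ hw
    rw [← sq_le_sq₀ (norm_nonneg _) (norm_nonneg _), ← normSq_eq_norm_sq, ← normSq_eq_norm_sq,
      normSq_apply, normSq_apply]
    simp
    nlinarith
  set f : ℝ → ℂ := fun x => E (x + w.im * I) with hf
  have hshift : ∀ x : ℝ, (fun y : ℝ => E (((x : ℂ) + w.im * I) + y)) = fun y => f (x + y) := by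
    intro x; funext y; simp only [hf]; congr 1; push_cast; ring
  have hc : ∀ x : ℝ, w.re ≤ x → x ≤ 0 → ContinuousAt f x := by
    intro x h1 h2
    have := hcont _ (hball x h1 h2) (by simp) (by simpa using h1)
    rw [hshift] at this
    have h3 : ContinuousAt (fun y : ℝ => y - x) x := by fun_prop
    have h4 := ContinuousAt.comp (f := fun y : ℝ => y - x) (x := x) (by simpa using this) h3
    refine h4.congr (Eventually.of_forall fun v => ?_)
    simp
  have h0 : f 0 = 0 := by
    have h1 : Tendsto f (𝓝[>] 0) (𝓝 (f 0)) :=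
      (hc 0 hre le_rfl).tendsto.mono_left nhdsWithin_le_nhds
    refine tendsto_nhds_unique h1 (tendsto_const_nhds.congr' ?_)
    have h2 : ∀ᶠ x : ℝ in 𝓝 0, (x : ℂ) + w.im * I ∈ Metric.ball (0 : ℂ) ρ := by
      have h3 : ContinuousAt (fun x : ℝ => (x : ℂ) + w.im * I) 0 := by fun_prop
      exact h3.eventually (Metric.isOpen_ball.mem_nhds (hball 0 hre le_rfl))
    filter_upwards [nhdsWithin_le_nhds h2, self_mem_nhdsWithin] with x hx hx0
    exact (hE _ hx (by simpa using hx0)).symm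
  have h1 := constant_of_has_deriv_right_zero (f := f) (a := w.re) (b := 0)
    (fun x hx => (hc x hx.1 hx.2).continuousWithinAt)
    (fun x hx => by
      have := hderiv _ (hball x hx.1 hx.2.le) (by simp) (by simpa using hx.1) (by simpa using hx.2)
      rw [hshift] at this
      have h3 : HasDerivAt (fun y : ℝ => y - x) 1 x := (hasDerivAt_id x).sub_const x
      have h4 := HasDerivAt.scomp (h := fun y : ℝ => y - x) x (by simpa using this) h3
      rw [smul_zero] at h4
      refine (h4.congr_of_eventuallyEq (Eventually.of_forall fun v => ?_)).hasDerivWithinAt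
      simp)
    0 ⟨hre, le_rfl⟩
  rw [h0] at h1
  simp only [hf, re_add_im] at h1
  exact h1.symm

theorem convex_ball_inter_re_pos (ρ : ℝ) :
    Convex ℝ (Metric.ball (0 : ℂ) ρ ∩ {z | 0 < z.re}) :=
  (convex_ball _ _).inter (convex_halfSpace_re_gt 0)

theorem isOpen_ball_inter_re_pos (ρ : ℝ) :
    IsOpen (Metric.ball (0 : ℂ) ρ ∩ {z | 0 < z.re}) :=
  Metric.isOpen_ball.inter (isOpen_lt continuous_const continuous_re)

theorem hasDerivAt_comp_add_ofReal {f : ℂ → ℂ} {f' z : ℂ} (h : HasDerivAt f f' z) :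
    HasDerivAt (fun x : ℝ => f (z + x)) f' 0 := by
  have h1 : HasDerivAt (fun x : ℝ => z + (x : ℂ)) 1 0 := by
    simpa using (ofRealCLM.hasDerivAt (x := (0 : ℝ))).const_add z
  have h2 : HasDerivAt f f' (z + ((0 : ℝ) : ℂ)) := by simpa using h
  exact (h2.comp (0 : ℝ) h1).congr_deriv (mul_one _)

theorem hasDerivAt_log_shiftPt {w : ℂ} {n : ℤ} (h : shiftPt w n ∈ slitPlane) :
    HasDerivAt (fun w => log (shiftPt w n)) (1 / shiftPt w n) w := by
  simpa using (hasDerivAt_shiftPt w n).clog h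

theorem shiftPt_mem_slitPlane_of_re_pos {w : ℂ} (h : 0 < w.re) (n : ℤ) :
    shiftPt w n ∈ slitPlane := Or.inl (by rwa [shiftPt_re])

theorem hasDerivAt_logOneSubExp {w : ℂ} (h : 1 - exp (-w) ∈ slitPlane) :
    HasDerivAt logOneSubExp (exp (-w) / (1 - exp (-w))) w := by
  have h2 : HasDerivAt (fun w : ℂ => 1 - exp (-w)) (exp (-w)) w := by
    simpa using (hasDerivAt_neg w).cexp.const_sub 1
  exact h2.clog h

/-- At a zero of `shiftPt` this is `x log x → 0`. It lets the dilogarithm identity pass horizontally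
through `2πin`, where the logarithm identity cannot. -/
theorem continuousAt_shiftPt_mul_log {z : ℂ} (n : ℤ) :
    ContinuousAt (fun x : ℝ => shiftPt (z + x) n * log (shiftPt (z + x) n)) 0 := by
  simp only [shiftPt_add]
  by_cases hz : shiftPt z n = 0
  · rw [hz]
    simp only [zero_add]
    rw [ContinuousAt]
    have h1 : Tendsto (fun x : ℝ => |x * Real.log x| + Real.pi * |x|) (𝓝 0) (𝓝 0) := by
      have : Continuous fun x : ℝ => |x * Real.log x| + Real.pi * |x| :=
        Real.continuous_mul_log.abs.add (continuous_const.mul continuous_abs)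
      simpa using this.tendsto 0
    simp only [ofReal_zero, zero_mul]
    refine squeeze_zero_norm (fun x => ?_) h1
    rw [norm_mul, Complex.norm_real, Real.norm_eq_abs, abs_mul]
    have h4 := Complex.norm_le_abs_re_add_abs_im (log (x : ℂ))
    rw [log_re, log_im, Complex.norm_real, Real.norm_eq_abs, Real.log_abs] at h4
    nlinarith [abs_arg_le_pi (x : ℂ), abs_nonneg x,
      mul_le_mul_of_nonneg_left h4 (abs_nonneg x),
      mul_le_mul_of_nonneg_left (abs_arg_le_pi (x : ℂ)) (abs_nonneg x)]
  · exact ContinuousAt.mul (by fun_prop) (continuousAt_log_add_ofReal hz)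

/-- On a disc, `log (1 - e^{-w})` and `Li₂(e^{-w})` differ from finite sums of `log (w + 2 π i n)`
and `(w + 2 π i n) (log (w + 2 π i n) - 1)` by holomorphic functions. -/
theorem exists_regularised_log_dilog (N : ℕ) : ∃ A q : ℂ → ℂ,
    (∀ w ∈ Metric.ball 0 (discRadius N), HasDerivAt A (q w) w) ∧
    (∀ w ∈ Metric.ball 0 (discRadius N), HasDerivAt q (cothTail N w - 1 / 2) w) ∧
    (∀ w ∈ Metric.ball 0 (discRadius N), (∀ n : ℤ, shiftPt w n ≠ 0) →
      logOneSubExp w = q w + ∑ n ∈ Finset.Icc (-(N : ℤ)) N, log (shiftPt w n)) ∧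
    (∀ w ∈ Metric.ball 0 (discRadius N), (∀ n : ℤ, shiftPt w n ≠ 0) →
      dilogExp w = A w + ∑ n ∈ Finset.Icc (-(N : ℤ)) N,
        (shiftPt w n * log (shiftPt w n) - shiftPt w n)) := by
  set B := Metric.ball (0 : ℂ) (discRadius N) with hB
  set s := Finset.Icc (-(N : ℤ)) N with hs
  have h1B : (1 : ℂ) ∈ B := by simpa [hB] using one_lt_discRadius N
  -- Two successive primitives, with constants fixed at 1, a point of the right half-plane that lies
  -- in every disc.
  obtain ⟨q, hq1, hq⟩ := (DifferentiableOn.isExactOn_ball (c := 0) (r := discRadius N)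
    (f := fun w => cothTail N w - 1 / 2) fun w hw =>
      ((hasDerivAt_cothTail hw).sub_const _).differentiableAt.differentiableWithinAt).with_val_at 1
      (logOneSubExp 1 - ∑ n ∈ s, log (shiftPt 1 n))
  obtain ⟨A, hA1, hA⟩ := (DifferentiableOn.isExactOn_ball (c := 0) (r := discRadius N)
    (f := q) fun w hw => (hq w hw).differentiableAt.differentiableWithinAt).with_val_at 1
      (dilogExp 1 - ∑ n ∈ s, (shiftPt 1 n * log (shiftPt 1 n) - shiftPt 1 n))
  have hHo := isOpen_ball_inter_re_pos (discRadius N)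
  have hHp := (convex_ball_inter_re_pos (discRadius N)).isPreconnected
  have h1H : (1 : ℂ) ∈ B ∩ {z | 0 < z.re} := ⟨h1B, by simp⟩
  have hL0 : ∀ w ∈ B, 0 < w.re → logOneSubExp w - (q w + ∑ n ∈ s, log (shiftPt w n)) = 0 := by
    have hd1 : ∀ w ∈ B ∩ {z | 0 < z.re}, HasDerivAt logOneSubExp (exp (-w) / (1 - exp (-w))) w :=
      fun w hw => hasDerivAt_logOneSubExp (one_sub_exp_neg_mem_slitPlane hw.2)
    have hd2 : ∀ w ∈ B ∩ {z | 0 < z.re},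
        HasDerivAt (fun w => q w + ∑ n ∈ s, log (shiftPt w n))
        (exp (-w) / (1 - exp (-w))) w := by
      intro w hw
      have hw0 := shiftPt_ne_zero_of_re_ne_zero (ne_of_gt hw.2)
      refine ((hq w hw.1).add (HasDerivAt.fun_sum fun n _ => hasDerivAt_log_shiftPt
        (shiftPt_mem_slitPlane_of_re_pos hw.2 n))).congr_deriv ?_
      rw [cothTail_eq hw.1 hw0, coth_half_eq (one_sub_exp_neg_ne_zero hw0)]
      ring
    have := hHo.eqOn_of_deriv_eq hHp
      (fun w hw => (hd1 w hw).differentiableAt.differentiableWithinAt)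
      (fun w hw => (hd2 w hw).differentiableAt.differentiableWithinAt)
      (fun w hw => by rw [(hd1 w hw).deriv, (hd2 w hw).deriv]) h1H (by rw [hq1]; ring)
    intro w hw hre
    exact sub_eq_zero.2 (this ⟨hw, hre⟩)
  have hD0 : ∀ w ∈ B, 0 < w.re → dilogExp w -
      (A w + ∑ n ∈ s, (shiftPt w n * log (shiftPt w n) - shiftPt w n)) = 0 := by
    have hd1 : ∀ w ∈ B ∩ {z | 0 < z.re}, HasDerivAt dilogExp (logOneSubExp w) w :=
      fun w hw => hasDerivAt_dilogExp hw.2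
    have hd2 : ∀ w ∈ B ∩ {z | 0 < z.re},
        HasDerivAt (fun w => A w + ∑ n ∈ s, (shiftPt w n * log (shiftPt w n) - shiftPt w n))
        (logOneSubExp w) w := by
      intro w hw
      have hw0 := shiftPt_ne_zero_of_re_ne_zero (ne_of_gt hw.2)
      refine ((hA w hw.1).add (HasDerivAt.fun_sum fun n _ => ((hasDerivAt_shiftPt w n).mul
        (hasDerivAt_log_shiftPt (shiftPt_mem_slitPlane_of_re_pos hw.2 n))).sub
        (hasDerivAt_shiftPt w n))).congr_deriv ?_
      rw [sub_eq_zero.1 (hL0 w hw.1 hw.2)]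
      congr 1
      refine Finset.sum_congr rfl fun n _ => ?_
      have := hw0 n
      field_simp
      ring
    have := hHo.eqOn_of_deriv_eq hHp
      (fun w hw => (hd1 w hw).differentiableAt.differentiableWithinAt)
      (fun w hw => (hd2 w hw).differentiableAt.differentiableWithinAt)
      (fun w hw => by rw [(hd1 w hw).deriv, (hd2 w hw).deriv]) h1H (by rw [hA1]; ring)
    intro w hw hre
    exact sub_eq_zero.2 (this ⟨hw, hre⟩)
  -- At heights outside `2πℤ` no cut is met, and the identity travels left from the right
  -- half-plane.
  have hLoff : ∀ w ∈ B, (∀ k : ℤ, (shiftPt w k).im ≠ 0) → w.re ≤ 0 →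
      logOneSubExp w - (q w + ∑ n ∈ s, log (shiftPt w n)) = 0 := by
    intro w hw him hre
    have hd : ∀ z ∈ B, z.im = w.im →
        HasDerivAt (fun w => logOneSubExp w - (q w + ∑ n ∈ s, log (shiftPt w n))) 0 z := by
      intro z hz hzw
      have him' : ∀ k : ℤ, (shiftPt z k).im ≠ 0 := fun k => by
        have := him k
        rwa [shiftPt_im, ← hzw, ← shiftPt_im] at this
      have hz0 : ∀ k : ℤ, shiftPt z k ≠ 0 := fun k h => him' k (by rw [h, zero_im])
      have hsl : 1 - exp (-z) ∈ slitPlane := by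
        by_contra h
        obtain ⟨k, hk⟩ := im_shiftPt_eq_zero_of_notMem_slitPlane h
        exact him' k hk
      refine ((hasDerivAt_logOneSubExp hsl).sub ((hq z hz).add (HasDerivAt.fun_sum fun n _ =>
        hasDerivAt_log_shiftPt (Or.inr (him' n))))).congr_deriv ?_
      rw [cothTail_eq hz hz0, coth_half_eq (one_sub_exp_neg_ne_zero hz0)]
      ring
    exact eq_zero_of_horizontal_deriv_eq_zero
      (E := fun w => logOneSubExp w - (q w + ∑ n ∈ s, log (shiftPt w n))) hw hre hL0
      (fun z hz hzw _ => (hasDerivAt_comp_add_ofReal (hd z hz hzw)).continuousAt)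
      (fun z hz hzw _ _ => hasDerivAt_comp_add_ofReal (hd z hz hzw))
  have hL : ∀ w ∈ B, (∀ n : ℤ, shiftPt w n ≠ 0) →
      logOneSubExp w = q w + ∑ n ∈ s, log (shiftPt w n) := by
    intro w hw hw0
    rcases lt_or_ge 0 w.re with hre | hre
    · exact sub_eq_zero.1 (hL0 w hw hre)
    by_cases him : ∀ k : ℤ, (shiftPt w k).im ≠ 0
    · exact sub_eq_zero.1 (hLoff w hw him hre)
    -- A line at a height in `2πℤ` can run through a pole, so such a point is reached from above
    -- instead: for `0 < t < 2π` the height of `w + ti` is outside `2πℤ`.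
    push Not at him
    obtain ⟨k, hk⟩ := him
    have hcont : Tendsto (fun t : ℝ => w + t * I) (𝓝[>] 0) (𝓝 w) := by
      have : ContinuousAt (fun t : ℝ => w + t * I) 0 := by fun_prop
      have h := this.tendsto.mono_left (nhdsWithin_le_nhds (s := Ioi 0))
      simpa using h
    have h1 := tendsto_logOneSubExp_add_mul_I (exp_neg_ne_one_iff.2 hw0) hk
    have h2 : Tendsto (fun t : ℝ => q (w + t * I) + ∑ n ∈ s, log (shiftPt (w + t * I) n))
        (𝓝[>] 0) (𝓝 (q w + ∑ n ∈ s, log (shiftPt w n))) := by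
      refine ((hq w hw).continuousAt.tendsto.comp hcont).add (tendsto_finsetSum _ fun n _ => ?_)
      simp only [shiftPt_add]
      exact tendsto_log_add_mul_I (hw0 n)
    refine tendsto_nhds_unique (h1.congr' ?_) h2
    filter_upwards [hcont.eventually (Metric.isOpen_ball.mem_nhds hw),
      Ioo_mem_nhdsGT (show (0 : ℝ) < 2 * Real.pi by positivity)] with t ht1 ht2
    refine sub_eq_zero.1 (hLoff _ ht1 (fun m hm => ?_) (by simpa using hre))
    rw [shiftPt_im] at hk hm
    have e : t = 2 * Real.pi * ((k - m : ℤ) : ℝ) := by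
      simp at hm
      push_cast
      linarith
    have hpi := Real.two_pi_pos
    have e1 : (0 : ℝ) < ((k - m : ℤ) : ℝ) := by
      by_contra hcon
      have := ht2.1
      nlinarith
    have e2 : ((k - m : ℤ) : ℝ) < 1 := by
      by_contra hcon
      have := ht2.2
      nlinarith
    have e1' : 0 < k - m := by exact_mod_cast e1
    have e2' : k - m < 1 := by exact_mod_cast e2
    omega
  refine ⟨A, q, hA, hq, hL, fun w hw hw0 => ?_⟩
  rcases lt_or_ge 0 w.re with hre | hre
  · exact sub_eq_zero.1 (hD0 w hw hre)
  -- Horizontal transport works at every height here: both sides stay continuous through `2πin`, and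
  -- their horizontal derivatives exist on the cuts.
  refine sub_eq_zero.1 (eq_zero_of_horizontal_deriv_eq_zero
    (E := fun w => dilogExp w - (A w + ∑ n ∈ s, (shiftPt w n * log (shiftPt w n) - shiftPt w n)))
    hw hre hD0 (fun z hz _ _ => ?_) fun z hz hzw _ hz0 => ?_)
  · refine (continuousAt_dilogExp_add_ofReal z).sub
      ((hasDerivAt_comp_add_ofReal (hA z hz)).continuousAt.add ?_)
    refine tendsto_finsetSum _ fun n _ => ?_
    refine (continuousAt_shiftPt_mul_log n).sub ?_
    simp only [shiftPt_add]
    fun_prop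
  · have hz0' := shiftPt_ne_zero_of_re_ne_zero hz0.ne
    have hlog : ∀ n : ℤ, HasDerivAt (fun x : ℝ => log (shiftPt (z + x) n)) (shiftPt z n)⁻¹ 0 := by
      intro n
      simp only [shiftPt_add]
      exact hasDerivAt_log_add_ofReal (hz0' n)
    refine ((hasDerivAt_dilogExp_add_ofReal (exp_neg_ne_one_iff.2 hz0')).sub
      ((hasDerivAt_comp_add_ofReal (hA z hz)).add (HasDerivAt.fun_sum fun n _ =>
        ((hasDerivAt_comp_add_ofReal (hasDerivAt_shiftPt z n)).mul (hlog n)).sub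
          (hasDerivAt_comp_add_ofReal (hasDerivAt_shiftPt z n))))).congr_deriv ?_
    rw [hL z hz hz0', sub_eq_zero]
    congr 1
    refine Finset.sum_congr rfl fun n _ => ?_
    have := hz0' n
    simp only [ofReal_zero, add_zero]
    field_simp
    ring

end Regularised

/-! ### The unconditional sum of logarithmic factors -/

section LogSum

open Complex Set MeasureTheory

/-- The logarithm of the `n`-th factor of the unconditional product. -/
noncomputable def logFactor (β y : ℂ) (n : ℤ) : ℂ :=
  (shiftPt y n / β + 1 / 2) * (log (shiftPt (y + β) n) - log (shiftPt y n)) - 1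

theorem exists_mem_ball_discRadius (r : ℝ) : ∃ N : ℕ, ∀ z : ℂ, ‖z‖ ≤ r →
    z ∈ Metric.ball (0 : ℂ) (discRadius N) := by
  obtain ⟨N, hN⟩ := exists_nat_gt r
  refine ⟨N, fun z hz => ?_⟩
  rw [mem_ball_zero_iff]
  have h1 := Real.pi_gt_three
  have h2 : (0 : ℝ) ≤ N := N.cast_nonneg
  unfold discRadius
  nlinarith

theorem hasDerivAt_add_ofReal_mul (y β : ℂ) (t : ℝ) :
    HasDerivAt (fun t : ℝ => y + t * β) β t := by
  simpa using ((ofRealCLM.hasDerivAt (x := t)).mul_const β).const_add y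

theorem hasDerivAt_comp_add_ofReal_mul {f : ℂ → ℂ} {f' y β : ℂ} {t : ℝ}
    (h : HasDerivAt f f' (y + t * β)) : HasDerivAt (fun t : ℝ => f (y + t * β)) (f' * β) t :=
  h.comp t (hasDerivAt_add_ofReal_mul y β t)

theorem segment_mem_ball {y β : ℂ} {ρ : ℝ} (hy : y ∈ Metric.ball (0 : ℂ) ρ)
    (hyβ : y + β ∈ Metric.ball (0 : ℂ) ρ) {t : ℝ} (ht : t ∈ Icc (0 : ℝ) 1) :
    y + t * β ∈ Metric.ball (0 : ℂ) ρ := by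
  have := (convex_ball (0 : ℂ) ρ) hy hyβ (sub_nonneg.2 ht.2) ht.1 (by ring)
  convert! this using 1
  simp only [real_smul]
  push_cast
  ring

/-- Binet-type integral for one logarithmic factor. -/
theorem mul_log_sub_log_eq_integral {w β : ℂ} (hβ : β ≠ 0)
    (h : ∀ t ∈ Icc (0 : ℝ) 1, w + t * β ∈ slitPlane) :
    (w / β + 1 / 2) * (log (w + β) - log w) - 1 =
      ∫ t in (0 : ℝ)..1, (1 / 2 * t * (1 - t) * β ^ 2 : ℂ) * (1 / (w + t * β) ^ 2) := by
  have hI : uIcc (0 : ℝ) 1 = Icc 0 1 := uIcc_of_le zero_le_one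
  -- Two integrations by parts against `t(1 - t)/2`, which vanishes at both ends, yield the mean of
  -- `log` over the segment minus the average of its end values.
  have := intervalIntegral.integral_eq_sub_of_hasDerivAt (a := 0) (b := 1)
    (f := fun t : ℝ => -(1 / 2 * t * (1 - t) * β : ℂ) * (w + t * β)⁻¹ +
      (w / β + 1 / 2) * log (w + t * β) - t)
    (f' := fun t : ℝ => (1 / 2 * t * (1 - t) * β ^ 2 : ℂ) * (1 / (w + t * β) ^ 2))
    (fun t ht => by
      rw [hI] at ht
      have ht0 := slitPlane_ne_zero (h t ht)
      have h1 := hasDerivAt_add_ofReal_mul w β t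
      have h2 : HasDerivAt (fun t : ℝ => (t : ℂ)) 1 t := ofRealCLM.hasDerivAt
      have h3 := ((((h2.const_mul (1 / 2)).mul (h2.const_sub 1)).mul_const β).neg.mul
        ((hasDerivAt_inv ht0).comp t h1)).add
        ((h1.clog_real (h t ht)).const_mul (w / β + 1 / 2))
      refine (h3.sub h2).congr_deriv ?_
      simp only [Function.comp, Pi.neg_apply, Pi.mul_apply]
      field_simp
      ring)
    (ContinuousOn.intervalIntegrable (by
      rw [hI]
      refine ContinuousOn.mul (by fun_prop) (ContinuousOn.div continuousOn_const (by fun_prop) ?_)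
      exact fun t ht => pow_ne_zero 2 (slitPlane_ne_zero (h t ht))))
  rw [this]
  simp
  ring

theorem logFactor_eq_integral {N : ℕ} {β y : ℂ} (hβ : β ≠ 0)
    (hy : y ∈ Metric.ball 0 (discRadius N)) (hyβ : y + β ∈ Metric.ball 0 (discRadius N)) {n : ℤ}
    (hn : n ∉ Finset.Icc (-(N : ℤ)) N) : logFactor β y n =
      ∫ t in (0 : ℝ)..1, -(1 / 2 * t * (1 - t) * β ^ 2 : ℂ) *
        derivCothTailTerm N n (y + t * β) := by
  rw [logFactor, shiftPt_add, mul_log_sub_log_eq_integral hβ fun t ht => by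
    have := im_shiftPt_ne_zero (segment_mem_ball hy hyβ ht) hn
    rw [shiftPt_add] at this
    exact Or.inr this]
  refine intervalIntegral.integral_congr fun t _ => ?_
  simp only [derivCothTailTerm, if_neg hn, shiftPt_add]
  ring

theorem continuousOn_derivCothTail (N : ℕ) :
    ContinuousOn (derivCothTail N) (Metric.ball 0 (discRadius N)) := by
  have h : DifferentiableOn ℂ (cothTail N) (Metric.ball 0 (discRadius N)) :=
    fun w hw => (hasDerivAt_cothTail hw).differentiableAt.differentiableWithinAt
  exact (h.deriv Metric.isOpen_ball).continuousOn.congr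
    fun w hw => (hasDerivAt_cothTail hw).deriv.symm

theorem continuousOn_derivCothTailTerm (N : ℕ) (n : ℤ) :
    ContinuousOn (derivCothTailTerm N n) (Metric.ball 0 (discRadius N)) := by
  unfold derivCothTailTerm
  split_ifs with hn
  · exact continuousOn_const
  · exact (ContinuousOn.div continuousOn_const
      (ContinuousOn.pow (fun w _ => (hasDerivAt_shiftPt w n).continuousAt.continuousWithinAt) 2)
      fun w hw => pow_ne_zero 2 (shiftPt_ne_zero_of_notMem hw hn)).neg

theorem hasSum_integral_derivCothTailTerm {N : ℕ} {β y : ℂ}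
    (hy : y ∈ Metric.ball 0 (discRadius N)) (hyβ : y + β ∈ Metric.ball 0 (discRadius N)) :
    HasSum (fun n : ℤ => ∫ t in (0 : ℝ)..1, -(1 / 2 * t * (1 - t) * β ^ 2 : ℂ) *
        derivCothTailTerm N n (y + t * β))
      (∫ t in (0 : ℝ)..1, -(1 / 2 * t * (1 - t) * β ^ 2 : ℂ) * derivCothTail N (y + t * β)) := by
  have hu := summable_const_mul_one_div_int_sq (‖β‖ ^ 2 * ((N + 1) / Real.pi) ^ 2)
  have hseg : ∀ t ∈ uIoc (0 : ℝ) 1, y + t * β ∈ Metric.ball (0 : ℂ) (discRadius N) := by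
    intro t ht
    rw [uIoc_of_le zero_le_one] at ht
    exact segment_mem_ball hy hyβ ⟨ht.1.le, ht.2⟩
  refine intervalIntegral.hasSum_integral_of_dominated_convergence
    (fun n _ => ‖β‖ ^ 2 * ((N + 1) / Real.pi) ^ 2 * (1 / (n : ℝ) ^ 2)) (fun n => ?_) (fun n => ?_)
    ?_ ?_ ?_
  · refine ContinuousOn.aestronglyMeasurable ?_ measurableSet_uIoc
    exact ContinuousOn.mul (by fun_prop) ((continuousOn_derivCothTailTerm N n).comp (by fun_prop)
      hseg)
  · refine Eventually.of_forall fun t ht => ?_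
    have h1 := norm_derivCothTailTerm_le (hseg t ht) n
    rw [uIoc_of_le zero_le_one] at ht
    rw [norm_mul, mul_assoc (‖β‖ ^ 2)]
    refine mul_le_mul ?_ h1 (norm_nonneg _) (by positivity)
    have e : (1 / 2 * t * (1 - t) * β ^ 2 : ℂ) = ((1 / 2 * t * (1 - t) : ℝ) : ℂ) * β ^ 2 := by
      push_cast; ring
    rw [norm_neg, e, norm_mul, Complex.norm_real, norm_pow, Real.norm_of_nonneg
      (mul_nonneg (by linarith [ht.1]) (by linarith [ht.2]))]
    have h2 := sq_nonneg ‖β‖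
    have : 1 / 2 * t * (1 - t) ≤ 1 := by nlinarith [ht.1, ht.2]
    nlinarith
  · exact Eventually.of_forall fun t _ => hu
  · exact intervalIntegrable_const
  · refine Eventually.of_forall fun t ht => ?_
    refine HasSum.mul_left _ (Summable.hasSum ?_)
    exact Summable.of_norm_bounded (summable_const_mul_one_div_int_sq _)
      fun n => norm_derivCothTailTerm_le (hseg t ht) n

/-- The same two integrations by parts with `q` in place of `log`: the mean of `q` over the segment,
computed by its primitive `A`, minus the average of its end values. -/
theorem integral_derivCothTail {N : ℕ} {β y : ℂ} {A q : ℂ → ℂ} (hβ : β ≠ 0)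
    (hA : ∀ w ∈ Metric.ball 0 (discRadius N), HasDerivAt A (q w) w)
    (hq : ∀ w ∈ Metric.ball 0 (discRadius N), HasDerivAt q (cothTail N w - 1 / 2) w)
    (hy : y ∈ Metric.ball 0 (discRadius N)) (hyβ : y + β ∈ Metric.ball 0 (discRadius N)) :
    ∫ t in (0 : ℝ)..1, -(1 / 2 * t * (1 - t) * β ^ 2 : ℂ) * derivCothTail N (y + t * β) =
      (A (y + β) - A y) / β - (q y + q (y + β)) / 2 := by
  have hI : uIcc (0 : ℝ) 1 = Icc 0 1 := uIcc_of_le zero_le_one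
  have := intervalIntegral.integral_eq_sub_of_hasDerivAt (a := 0) (b := 1)
    (f := fun t : ℝ => -(1 / 2 * t * (1 - t) * β : ℂ) * (cothTail N (y + t * β) - 1 / 2) +
      (1 / 2 - t) * q (y + t * β) + 1 / β * A (y + t * β))
    (f' := fun t : ℝ => -(1 / 2 * t * (1 - t) * β ^ 2 : ℂ) * derivCothTail N (y + t * β))
    (fun t ht => by
      rw [hI] at ht
      have hb := segment_mem_ball hy hyβ ht
      have h2 : HasDerivAt (fun t : ℝ => (t : ℂ)) 1 t := ofRealCLM.hasDerivAt
      have h3 := (((((h2.const_mul (1 / 2)).mul (h2.const_sub 1)).mul_const β).neg.mul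
        ((hasDerivAt_comp_add_ofReal_mul (hasDerivAt_cothTail hb)).sub_const (1 / 2))).add
        ((h2.const_sub (1 / 2)).mul (hasDerivAt_comp_add_ofReal_mul (hq _ hb)))).add
        ((hasDerivAt_comp_add_ofReal_mul (hA _ hb)).const_mul (1 / β))
      refine h3.congr_deriv ?_
      simp only [Pi.neg_apply, Pi.mul_apply]
      field_simp
      ring)
    (ContinuousOn.intervalIntegrable (by
      rw [hI]
      exact ContinuousOn.mul (by fun_prop) ((continuousOn_derivCothTail N).comp (by fun_prop)
        fun t ht => segment_mem_ball hy hyβ ht)))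
  rw [this]
  simp
  ring

/-- The terms with `|n| > N` are summed under the integral. The finitely many others supply exactly
the logarithms missing from `q` and `A`; they are never written as integrals, so the segment from
`y` to `y + β` may cross cuts or poles. -/
theorem hasSum_logFactor {β y : ℂ} (hβ : β ≠ 0) (hy : ∀ n : ℤ, shiftPt y n ≠ 0)
    (hyβ : ∀ n : ℤ, shiftPt (y + β) n ≠ 0) :
    HasSum (logFactor β y) ((dilogExp (y + β) - dilogExp y) / β -
      (logOneSubExp y + logOneSubExp (y + β)) / 2) := by
  obtain ⟨N, hN⟩ := exists_mem_ball_discRadius (‖y‖ + ‖β‖)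
  have hyB := hN y (by linarith [norm_nonneg β])
  have hyβB := hN (y + β) (norm_add_le _ _)
  obtain ⟨A, q, hA, hq, hL, hD⟩ := exists_regularised_log_dilog N
  have h1 := hasSum_integral_derivCothTailTerm hyB hyβB
  rw [integral_derivCothTail hβ hA hq hyB hyβB] at h1
  have h2 := hasSum_sum_of_ne_finset_zero (s := Finset.Icc (-(N : ℤ)) N)
    (L := SummationFilter.unconditional ℤ)
    (f := fun n : ℤ => if n ∈ Finset.Icc (-(N : ℤ)) N then logFactor β y n else 0)
    (fun n hn => if_neg hn)
  have h3 := h1.add h2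
  convert! h3 using 1
  · funext n
    by_cases hn : n ∈ Finset.Icc (-(N : ℤ)) N
    · simp [hn, derivCothTailTerm]
    · rw [if_neg hn, add_zero, logFactor_eq_integral hβ hyB hyβB hn]
  · rw [Finset.sum_congr rfl fun n hn => if_pos hn, hL y hyB hy, hL _ hyβB hyβ, hD y hyB hy,
      hD _ hyβB hyβ]
    have e : ∑ n ∈ Finset.Icc (-(N : ℤ)) N, logFactor β y n =
        (∑ n ∈ Finset.Icc (-(N : ℤ)) N, (shiftPt (y + β) n * log (shiftPt (y + β) n) -
          shiftPt (y + β) n) - ∑ n ∈ Finset.Icc (-(N : ℤ)) N, (shiftPt y n * log (shiftPt y n) -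
          shiftPt y n)) / β - (∑ n ∈ Finset.Icc (-(N : ℤ)) N, log (shiftPt y n) +
          ∑ n ∈ Finset.Icc (-(N : ℤ)) N, log (shiftPt (y + β) n)) / 2 := by
      rw [← Finset.sum_sub_distrib, ← Finset.sum_add_distrib, Finset.sum_div, Finset.sum_div,
        ← Finset.sum_sub_distrib]
      refine Finset.sum_congr rfl fun n _ => ?_
      rw [logFactor, shiftPt_add]
      field_simp
      ring
    rw [e]
    ring

end LogSum

/-! ### Stirling's formula by telescoping -/

section Stirling

open Complex

theorem add_natCast_mul_mem_slitPlane {w β : ℂ} (hw : 0 < w.re) (hβ : 0 < β.re) (m : ℕ) :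
    w + m * β ∈ slitPlane := by
  left
  simp only [add_re, mul_re, natCast_re, natCast_im, zero_mul, sub_zero]
  positivity

theorem exp_log_sub_log {w β : ℂ} (hw : w ≠ 0) (hβ : β ≠ 0) : exp (log w - log β) = w / β := by
  rw [Complex.exp_sub, exp_log hw, exp_log hβ]

/-- Summation by parts: the weights of consecutive logarithms differ by 1, which leaves one factor
`1 / (w / β + m)` for each `m` and two boundary terms. -/
theorem exp_sum_mul_log_sub_log {w β : ℂ} (hw : 0 < w.re) (hβ : 0 < β.re) (M : ℕ) :
    exp (∑ m ∈ Finset.range M, (((w + m * β) / β + 1 / 2) *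
      (log (w + (m + 1 : ℕ) * β) - log (w + m * β)) - 1)) =
    exp ((w / β + M - 1 / 2) * (log (w + M * β) - log β)) * exp (-M) *
      exp (-((w / β - 1 / 2) * (log w - log β))) / ∏ m ∈ Finset.range M, (w / β + m) := by
  have hβ0 : β ≠ 0 := fun h => by simp [h] at hβ
  induction M with
  | zero => simp [← Complex.exp_add]
  | succ M ih =>
    have h1 := slitPlane_ne_zero (add_natCast_mul_mem_slitPlane hw hβ M)
    have h2 : w / β + M = exp (log (w + M * β) - log β) := by
      rw [exp_log_sub_log h1 hβ0]; field_simp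
    have h3 : (w + M * β) / β = w / β + M := by field_simp
    rw [Finset.sum_range_succ, Complex.exp_add, ih, Finset.prod_range_succ, h3]
    have h4 : (w / β + M)⁻¹ = exp (-(log (w + M * β) - log β)) := by
      rw [Complex.exp_neg, ← h2]
    rw [div_mul_eq_mul_div, mul_comm (∏ m ∈ Finset.range M, (w / β + m)), ← div_div]
    congr 1
    rw [div_eq_mul_inv _ (w / β + M), h4]
    simp only [← Complex.exp_add]
    congr 1
    push_cast
    ring

theorem log_add_natCast_mul {w β : ℂ} (hw : 0 < w.re)
    (hβ : 0 < β.re) {M : ℕ} (hM : 0 < M) :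
    log (w + M * β) = log M + log (β + (M : ℂ)⁻¹ * w) := by
  have hM' : (0 : ℝ) < M := by exact_mod_cast hM
  have hM0 : (M : ℂ) ≠ 0 := by exact_mod_cast hM.ne'
  have e : w + M * β = ((M : ℝ) : ℂ) * (β + (M : ℂ)⁻¹ * w) := by
    push_cast; field_simp; ring
  have hne : β + (M : ℂ)⁻¹ * w ≠ 0 := by
    intro h
    rw [h, mul_zero] at e
    exact slitPlane_ne_zero (add_natCast_mul_mem_slitPlane hw hβ M) e
  rw [e, log_ofReal_mul hM' hne, ← natCast_log]

/-- `M` times the difference is a difference quotient of `log (β + t w)` at `t = 0` with `t = 1 /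
M`; the part with `c` tends to 0. -/
theorem tendsto_mul_log_add_inv_mul (w : ℂ) {β : ℂ} (hβ : 0 < β.re) (c : ℂ) :
    Tendsto (fun M : ℕ => (c + M) * (log (β + (M : ℂ)⁻¹ * w) - log β)) atTop (𝓝 (w / β)) := by
  have h1 : HasDerivAt (fun t : ℂ => log (β + t * w)) (w / β) 0 := by
    have h : HasDerivAt (fun t : ℂ => β + t * w) w 0 := by
      simpa using ((hasDerivAt_id (0 : ℂ)).mul_const w).const_add β
    have := h.clog (by rw [zero_mul, add_zero]; exact Or.inl hβ)
    simpa using this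
  have h2 : Tendsto (fun M : ℕ => (M : ℂ)⁻¹) atTop (𝓝[≠] 0) := by
    refine tendsto_nhdsWithin_iff.2 ⟨tendsto_inv_atTop_nhds_zero_nat, ?_⟩
    filter_upwards [eventually_gt_atTop 0] with M hM
    have : (M : ℂ) ≠ 0 := by exact_mod_cast hM.ne'
    simpa using this
  have h3 := h1.tendsto_slope_zero.comp h2
  have h4 := (h1.continuousAt.tendsto.comp (h2.mono_right nhdsWithin_le_nhds)).sub_const (log β)
  have h5 := h3.add (h4.const_mul c)
  simp only [zero_add, zero_mul, add_zero, sub_self, mul_zero] at h5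
  refine h5.congr fun M => ?_
  simp only [Function.comp, inv_inv, smul_eq_mul]
  ring

/-- Stirling's formula for the complex Gamma function, as an infinite sum of logarithms. -/
theorem tendsto_exp_sum_mul_log_sub_log {w β : ℂ} (hw : 0 < w.re) (hβ : 0 < β.re) :
    Tendsto (fun M : ℕ => exp (∑ m ∈ Finset.range M, (((w + m * β) / β + 1 / 2) *
      (log (w + (m + 1 : ℕ) * β) - log (w + m * β)) - 1))) atTop
      (𝓝 (Gamma (w / β) / (Real.sqrt (2 * Real.pi) : ℝ) * exp (w / β) *
        exp (-((w / β - 1 / 2) * (log w - log β))))) := by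
  have hβ0 : β ≠ 0 := fun h => by simp [h] at hβ
  set x := w / β with hx
  -- `stirlingSeq M` is `M! / (√(2M) (M/e)^M)` with limit `√π`; the further `√2` completes `√(2π)`.
  have hS : Tendsto (fun M : ℕ => ((Stirling.stirlingSeq M : ℝ) : ℂ)⁻¹ /
      (Real.sqrt 2 : ℝ)) atTop (𝓝 (1 / (Real.sqrt (2 * Real.pi) : ℝ))) := by
    have h1 := (continuous_ofReal.tendsto _).comp Stirling.tendsto_stirlingSeq_sqrt_pi
    have h2 : ((Real.sqrt Real.pi : ℝ) : ℂ) ≠ 0 := by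
      exact_mod_cast (Real.sqrt_pos.2 Real.pi_pos).ne'
    have h3 := (h1.inv₀ h2).div_const ((Real.sqrt 2 : ℝ) : ℂ)
    convert! h3 using 2
    rw [Real.sqrt_mul (by norm_num)]
    push_cast
    rw [one_div, mul_inv]
    ring
  have hG := GammaSeq_tendsto_Gamma x
  have hD := (Complex.continuous_exp.tendsto _).comp (tendsto_mul_log_add_inv_mul w hβ (x - 1 / 2))
  -- `GammaSeq x M` has `M + 1` factors in its denominator, the partial sum only `M`. The factor `(x
  -- + M) / M` makes up for this.
  have hM1 : Tendsto (fun M : ℕ => x * (M : ℂ)⁻¹ + 1) atTop (𝓝 1) := by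
    simpa using ((tendsto_inv_atTop_nhds_zero_nat (𝕜 := ℂ)).const_mul x).add_const 1
  have hT := ((((hG.mul hS).mul hD).mul hM1).mul_const
    (exp (-((x - 1 / 2) * (log w - log β)))))
  have e : Gamma x / (Real.sqrt (2 * Real.pi) : ℝ) * exp x *
      exp (-((x - 1 / 2) * (log w - log β))) = Gamma x * (1 / (Real.sqrt (2 * Real.pi) : ℝ)) *
      exp (w / β) * 1 * exp (-((x - 1 / 2) * (log w - log β))) := by
    rw [← hx]; ring
  rw [e]
  refine hT.congr' ?_
  filter_upwards [eventually_gt_atTop 0] with M hM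
  rw [exp_sum_mul_log_sub_log hw hβ]
  have hM' : (0 : ℝ) < M := by exact_mod_cast hM
  have hM0 : (M : ℂ) ≠ 0 := by exact_mod_cast hM.ne'
  have hx0 : ∀ m : ℕ, x + m ≠ 0 := fun m h => by
    have := slitPlane_ne_zero (add_natCast_mul_mem_slitPlane hw hβ m)
    apply this
    have e : w + m * β = β * (x + m) := by rw [hx]; field_simp
    rw [e, h, mul_zero]
  have hP : ∏ m ∈ Finset.range M, (x + m) ≠ 0 := Finset.prod_ne_zero_iff.2 fun m _ => hx0 m
  have hf : ((M.factorial : ℕ) : ℂ) ≠ 0 := by exact_mod_cast M.factorial_ne_zero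
  have h2 : ((Real.sqrt 2 : ℝ) : ℂ) ≠ 0 := by
    exact_mod_cast (Real.sqrt_pos.2 (by norm_num : (0 : ℝ) < 2)).ne'
  have hsM : ((Real.sqrt M : ℝ) : ℂ) = exp (1 / 2 * log M) := by
    rw [← natCast_log, Real.sqrt_eq_rpow, Real.rpow_def_of_pos hM', ofReal_exp]
    push_cast
    congr 1
    ring
  have hpow : (M : ℂ) ^ M = exp (M * log M) := by
    rw [Complex.exp_nat_mul, exp_log hM0]
  rw [log_add_natCast_mul hw hβ hM, GammaSeq, Finset.prod_range_succ,
    Stirling.stirlingSeq, Real.sqrt_mul (by norm_num), cpow_def_of_ne_zero hM0]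
  push_cast
  rw [hsM, div_pow, hpow, ← Complex.exp_nat_mul]
  have e1 : exp ((x + M - 1 / 2) * (log M + log (β + (M : ℂ)⁻¹ * w) - log β)) =
      exp (log M * x) * exp (M * log M) * exp (1 / 2 * log M) * (exp (log M))⁻¹ *
      exp ((x - 1 / 2 + M) * (log (β + (M : ℂ)⁻¹ * w) - log β)) := by
    rw [← Complex.exp_neg]
    simp only [← Complex.exp_add]
    congr 1
    ring
  have e2 : exp (-(M : ℂ)) = (exp (M * 1))⁻¹ := by rw [← Complex.exp_neg, mul_one]
  rw [e1, e2, exp_log hM0]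
  have h5 := Complex.exp_ne_zero ((M : ℂ) * 1)
  have h6 := Complex.exp_ne_zero (1 / 2 * log M)
  have h7 := Complex.exp_ne_zero (M * log M)
  have h8 := hx0 M
  simp only [Function.comp]
  generalize exp ((M : ℂ) * 1) = E1 at *
  generalize exp (1 / 2 * log M) = E2 at *
  generalize exp (M * log M) = E3 at *
  generalize exp (log M * x) = E4
  generalize exp ((x - 1 / 2 + M) * (log (β + (M : ℂ)⁻¹ * w) - log β)) = E5
  generalize exp (-((x - 1 / 2) * (log w - log β))) = E6
  generalize ((Real.sqrt 2 : ℝ) : ℂ) = E7 at *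
  generalize ∏ m ∈ Finset.range M, (x + (m : ℂ)) = Q at *
  have e8 : x * (M : ℂ)⁻¹ + 1 = (x + M) / M := by field_simp
  rw [e8]
  field_simp

end Stirling

/-! ### The double sum over `ℤ × ℕ` and the principal value product -/

section DoubleSum

open Complex Set

/-- Second order Binet-type integral for one logarithmic factor. -/
theorem mul_log_sub_log_sub_eq_integral {w β : ℂ} (hβ : β ≠ 0)
    (h : ∀ t ∈ Icc (0 : ℝ) 1, w + t * β ∈ slitPlane) :
    (w / β + 1 / 2) * (log (w + β) - log w) - 1 - 1 / 12 * (β / w - β / (w + β)) =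
      ∫ t in (0 : ℝ)..1, ((t ^ 2 / 2 - t ^ 3 / 3 - t / 6) * β ^ 3 : ℂ) *
        (1 / (w + t * β) ^ 3) := by
  have hI : uIcc (0 : ℝ) 1 = Icc 0 1 := uIcc_of_le zero_le_one
  -- The weight is `-B₃(t)/3`, with the Bernoulli polynomial `B₃` vanishing at both ends, and its
  -- derivative is `-B₂(t)`. The end values `B₂(0) = B₂(1) = 1/6` produce the `1 / 12`.
  have := intervalIntegral.integral_eq_sub_of_hasDerivAt (a := 0) (b := 1)
    (f := fun t : ℝ => -((t ^ 2 / 2 - t ^ 3 / 3 - t / 6) * β ^ 2 / 2 : ℂ) * ((w + t * β)⁻¹) ^ 2 -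
      ((t - t ^ 2 - 1 / 6) * β / 2 : ℂ) * (w + t * β)⁻¹ +
      (w / β + 1 / 2) * log (w + t * β) - t)
    (f' := fun t : ℝ => ((t ^ 2 / 2 - t ^ 3 / 3 - t / 6) * β ^ 3 : ℂ) *
        (1 / (w + t * β) ^ 3))
    (fun t ht => by
      rw [hI] at ht
      have ht0 := slitPlane_ne_zero (h t ht)
      have h1 := hasDerivAt_add_ofReal_mul w β t
      have h2 : HasDerivAt (fun t : ℝ => (t : ℂ)) 1 t := ofRealCLM.hasDerivAt
      have hinv := (hasDerivAt_inv ht0).comp t h1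
      have hc : HasDerivAt (fun t : ℝ => (t ^ 2 / 2 - t ^ 3 / 3 - t / 6 : ℂ))
          (t - t ^ 2 - 1 / 6) t := by
        refine ((((h2.pow 2).div_const 2).sub ((h2.pow 3).div_const 3)).sub
          (h2.div_const 6)).congr_deriv ?_
        push_cast
        ring
      have hc' : HasDerivAt (fun t : ℝ => (t - t ^ 2 - 1 / 6 : ℂ)) (1 - 2 * t) t := by
        refine ((h2.sub (h2.pow 2)).sub_const (1 / 6)).congr_deriv ?_
        push_cast
        ring
      have h3 := (((((hc.mul_const (β ^ 2)).div_const 2).neg.mul (hinv.pow 2)).sub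
        (((hc'.mul_const β).div_const 2).mul hinv)).add
        ((h1.clog_real (h t ht)).const_mul (w / β + 1 / 2))).sub h2
      refine h3.congr_deriv ?_
      simp only [Function.comp, Pi.neg_apply, Pi.pow_apply, Nat.cast_ofNat, Nat.add_one_sub_one,
        pow_one]
      field_simp
      ring)
    (ContinuousOn.intervalIntegrable (by
      rw [hI]
      refine ContinuousOn.mul (by fun_prop) (ContinuousOn.div continuousOn_const (by fun_prop) ?_)
      exact fun t ht => pow_ne_zero 3 (slitPlane_ne_zero (h t ht))))
  rw [this]
  simp
  ring

theorem norm_mul_log_sub_log_sub_le {w β : ℂ} (hβ : β ≠ 0) {c : ℝ} (hc : 0 < c)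
    (h : ∀ t ∈ Icc (0 : ℝ) 1, w + t * β ∈ slitPlane)
    (hw : ∀ t ∈ Icc (0 : ℝ) 1, c ≤ ‖w + t * β‖) :
    ‖(w / β + 1 / 2) * (log (w + β) - log w) - 1 - 1 / 12 * (β / w - β / (w + β))‖ ≤
      ‖β‖ ^ 3 * (1 / c ^ 3) := by
  rw [mul_log_sub_log_sub_eq_integral hβ h]
  have := intervalIntegral.norm_integral_le_of_norm_le_const (a := 0) (b := 1)
    (C := ‖β‖ ^ 3 * (1 / c ^ 3)) (f := fun t : ℝ =>
      ((t ^ 2 / 2 - t ^ 3 / 3 - t / 6) * β ^ 3 : ℂ) * (1 / (w + t * β) ^ 3)) (fun t ht => by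
        rw [uIoc_of_le zero_le_one] at ht
        have ht' : t ∈ Icc (0 : ℝ) 1 := ⟨ht.1.le, ht.2⟩
        rw [norm_mul, norm_div, norm_one, norm_pow]
        have h1 : 1 / ‖w + t * β‖ ^ 3 ≤ 1 / c ^ 3 :=
          one_div_le_one_div_of_le (by positivity) (pow_le_pow_left₀ hc.le (hw t ht') 3)
        have e : ((t ^ 2 / 2 - t ^ 3 / 3 - t / 6) * β ^ 3 : ℂ) =
            ((t ^ 2 / 2 - t ^ 3 / 3 - t / 6 : ℝ) : ℂ) * β ^ 3 := by push_cast; ring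
        have h2 : ‖((t ^ 2 / 2 - t ^ 3 / 3 - t / 6) * β ^ 3 : ℂ)‖ ≤ ‖β‖ ^ 3 := by
          rw [e, norm_mul, norm_pow, Complex.norm_real, Real.norm_eq_abs]
          have h3 : |t ^ 2 / 2 - t ^ 3 / 3 - t / 6| ≤ 1 := by
            have h4 : t ^ 2 ≤ 1 := by nlinarith [ht'.1, ht'.2]
            have h5 : 0 ≤ t ^ 3 := pow_nonneg ht'.1 3
            have h6 : t ^ 3 ≤ 1 := pow_le_one₀ ht'.1 ht'.2
            rw [abs_le]
            constructor <;> nlinarith [ht'.1, ht'.2, sq_nonneg t]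
          have := pow_nonneg (norm_nonneg β) 3
          nlinarith
        exact mul_le_mul h2 h1 (by positivity) (by positivity))
  simpa using this

theorem exists_lattice_bound {y β : ℂ} (hy : 0 < y.re) (hβ : 0 < β.re) :
    ∃ c : ℝ, 0 < c ∧ ∀ (n : ℤ) (m : ℕ), ∀ t ∈ Icc (0 : ℝ) 1,
      c * (|(n : ℝ)| + m + 1) ≤ ‖shiftPt y n + m * β + t * β‖ := by
  set μ := min y.re β.re with hμ
  have hμ0 : 0 < μ := lt_min hy hβ
  set K := |y.im| + |β.im| with hK
  have hK0 : 0 ≤ K := by positivity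
  have hd : 0 < 1 + (K + 1) / μ := by positivity
  -- The real part gives `m + 1 ≤ ‖z‖ / μ`, the imaginary part `|n| ≤ ‖z‖ + K (m + 1)`; the constant
  -- comes from adding the two.
  refine ⟨(1 + (K + 1) / μ)⁻¹, by positivity, fun n m t ht => ?_⟩
  have hm : (0 : ℝ) ≤ m := m.cast_nonneg
  set z := shiftPt y n + m * β + t * β with hz
  have hre : z.re = y.re + (m + t) * β.re := by
    simp [hz, shiftPt_re]; ring
  have him : z.im = y.im + 2 * Real.pi * n + (m + t) * β.im := by
    simp [hz, shiftPt_im]; ring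
  have h1 : μ * (m + 1) ≤ ‖z‖ := by
    refine le_trans ?_ (re_le_norm z)
    rw [hre]
    have h2 : μ ≤ y.re := min_le_left _ _
    have h3 : μ ≤ β.re := min_le_right _ _
    nlinarith [ht.1]
  have h2 : |(n : ℝ)| ≤ ‖z‖ + K * (m + 1) := by
    have h3 := abs_im_le_norm z
    have e : 2 * Real.pi * (n : ℝ) = z.im + (-y.im) + (-((m + t) * β.im)) := by rw [him]; ring
    have h4 : |2 * Real.pi * (n : ℝ)| ≤ |z.im| + |y.im| + (m + 1) * |β.im| := by
      rw [e]
      refine (abs_add_three _ _ _).trans ?_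
      rw [abs_neg, abs_neg, abs_mul, abs_of_nonneg (by linarith [ht.1] : (0 : ℝ) ≤ m + t)]
      nlinarith [abs_nonneg β.im, ht.2]
    rw [abs_mul, abs_of_pos Real.two_pi_pos] at h4
    have h5 := abs_nonneg (n : ℝ)
    have h6 : |(n : ℝ)| ≤ 2 * Real.pi * |(n : ℝ)| := by nlinarith [Real.pi_gt_three]
    nlinarith [abs_nonneg y.im]
  rw [inv_mul_le_iff₀ hd]
  have h3 : (m : ℝ) + 1 ≤ ‖z‖ / μ := by rw [le_div_iff₀ hμ0]; linarith
  have h4 : (1 + (K + 1) / μ) * ‖z‖ = ‖z‖ + K * (‖z‖ / μ) + ‖z‖ / μ := by field_simp; ring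
  rw [h4]
  nlinarith

/-- The exponent 3 exceeds the rank 2 of the lattice, as for Eisenstein series. Using `m + 1` as
second coordinate keeps the image of the injection away from the origin. -/
theorem summable_lattice : Summable fun p : ℤ × ℕ => 1 / (|(p.1 : ℝ)| + p.2 + 1) ^ 3 := by
  have h := EisensteinSeries.summable_one_div_norm_rpow (k := 3) (by norm_num)
  have hinj : Function.Injective fun p : ℤ × ℕ => ![p.1, (p.2 : ℤ) + 1] := by
    rintro ⟨a, b⟩ ⟨a', b'⟩ hab
    have h1 := congrFun hab 0
    have h2 := congrFun hab 1
    simp at h1 h2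
    exact Prod.ext h1 h2
  refine Summable.of_nonneg_of_le (fun p => by positivity) (fun p => ?_) (h.comp_injective hinj)
  simp only [Function.comp]
  have hpos : 0 < ‖![p.1, (p.2 : ℤ) + 1]‖ := by
    have := EisensteinSeries.abs_le_right_of_norm ((p.2 : ℤ) + 1) p.1
    refine lt_of_lt_of_le ?_ this
    push_cast
    positivity
  have hle : ‖![p.1, (p.2 : ℤ) + 1]‖ ≤ |(p.1 : ℝ)| + p.2 + 1 := by
    rw [pi_norm_le_iff_of_nonneg (by positivity)]
    intro i
    fin_cases i
    · simp [Int.norm_eq_abs]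
      linarith [(p.2.cast_nonneg : (0 : ℝ) ≤ p.2)]
    · simp only [Fin.mk_one, Matrix.cons_val_one, Matrix.cons_val_fin_one, Int.norm_eq_abs]
      push_cast
      rw [abs_of_nonneg (by positivity)]
      linarith [abs_nonneg (p.1 : ℝ)]
  rw [Real.rpow_neg hpos.le, one_div]
  refine inv_anti₀ (by positivity) ?_
  rw [show (3 : ℝ) = ((3 : ℕ) : ℝ) by norm_num, Real.rpow_natCast]
  exact pow_le_pow_left₀ hpos.le hle 3

/-- The logarithmic factor at `y + m β`, corrected by the leading term of its expansion. -/
noncomputable def correctedLogFactor (β y : ℂ) (p : ℤ × ℕ) : ℂ :=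
  logFactor β (y + p.2 * β) p.1 -
    1 / 12 * (β / shiftPt (y + p.2 * β) p.1 - β / shiftPt (y + (p.2 + 1 : ℕ) * β) p.1)

theorem re_add_natCast_mul_pos {y β : ℂ} (hy : 0 < y.re) (hβ : 0 < β.re) (m : ℕ) :
    0 < (y + m * β).re := by
  simp only [add_re, mul_re, natCast_re, natCast_im, zero_mul, sub_zero]
  positivity

theorem add_natCast_succ_mul (y β : ℂ) (m : ℕ) :
    y + (m + 1 : ℕ) * β = y + m * β + β := by
  push_cast; ring

/-- Uncorrected terms are bounded only quadratically, which is too weak over a rank 2 lattice; the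
telescoping correction gains one power. -/
theorem summable_correctedLogFactor {y β : ℂ} (hy : 0 < y.re) (hβ : 0 < β.re) :
    Summable (correctedLogFactor β y) := by
  have hβ0 : β ≠ 0 := fun h => by simp [h] at hβ
  obtain ⟨c, hc, hb⟩ := exists_lattice_bound hy hβ
  refine Summable.of_norm_bounded (summable_lattice.mul_left (‖β‖ ^ 3 * (1 / c ^ 3)))
    fun p => ?_
  have hpos : 0 < |(p.1 : ℝ)| + p.2 + 1 := by positivity
  have h := norm_mul_log_sub_log_sub_le (w := shiftPt (y + p.2 * β) p.1) hβ0 (mul_pos hc hpos)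
    (fun t ht => by
      left
      have := re_add_natCast_mul_pos hy hβ p.2
      rw [add_re, shiftPt_re]
      have h2 : 0 ≤ (t * β : ℂ).re := by
        simp only [mul_re, ofReal_re, ofReal_im, zero_mul, sub_zero]
        exact mul_nonneg ht.1 hβ.le
      linarith)
    (fun t ht => by rw [shiftPt_add]; exact hb p.1 p.2 t ht)
  rw [correctedLogFactor, logFactor, add_natCast_succ_mul, shiftPt_add _ β]
  refine h.trans (le_of_eq ?_)
  rw [mul_pow]
  field_simp

theorem tendsto_natCast_mul_re_atTop (y : ℂ) {β : ℂ} (hβ : 0 < β.re) :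
    Tendsto (fun m : ℕ => (y + m * β).re) atTop atTop := by
  simp only [add_re, mul_re, natCast_re, natCast_im, zero_mul, sub_zero]
  exact tendsto_atTop_add_const_left _ _
    ((tendsto_natCast_atTop_atTop (R := ℝ)).atTop_mul_const hβ)

theorem tendsto_const_div_shiftPt_add (y : ℂ) {β : ℂ} (hβ : 0 < β.re) (n : ℤ) (a : ℂ) :
    Tendsto (fun m : ℕ => a / shiftPt (y + m * β) n) atTop (𝓝 0) := by
  have h1 : Tendsto (fun m : ℕ => shiftPt (y + m * β) n) atTop (Bornology.cobounded ℂ) := by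
    rw [← tendsto_norm_atTop_iff_cobounded]
    refine tendsto_atTop_mono (fun m => ?_) (tendsto_natCast_mul_re_atTop y hβ)
    rw [← shiftPt_re _ n]
    exact re_le_norm _
  have h2 := (tendsto_inv₀_cobounded.comp h1).const_mul a
  rw [mul_zero] at h2
  exact h2.congr fun m => (div_eq_mul_inv _ _).symm

theorem tendsto_exp_neg_add_natCast_mul (y : ℂ) {β : ℂ} (hβ : 0 < β.re) :
    Tendsto (fun m : ℕ => exp (-(y + m * β))) atTop (𝓝 0) := by
  rw [tendsto_zero_iff_norm_tendsto_zero]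
  simp only [Complex.norm_exp, neg_re]
  exact Real.tendsto_exp_neg_atTop_nhds_zero.comp (tendsto_natCast_mul_re_atTop y hβ)

theorem tendsto_dilogExp_add_natCast_mul (y : ℂ) {β : ℂ} (hβ : 0 < β.re) :
    Tendsto (fun m : ℕ => dilogExp (y + m * β)) atTop (𝓝 0) :=
  tendsto_dilog_zero.comp (tendsto_exp_neg_add_natCast_mul y hβ)

theorem tendsto_logOneSubExp_add_natCast_mul (y : ℂ) {β : ℂ} (hβ : 0 < β.re) :
    Tendsto (fun m : ℕ => logOneSubExp (y + m * β)) atTop (𝓝 0) := by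
  have h := ((tendsto_exp_neg_add_natCast_mul y hβ).const_sub 1).clog
    (by rw [sub_zero]; exact one_mem_slitPlane)
  rw [sub_zero, log_one] at h
  exact h

theorem tendsto_coth_add_natCast_mul (y : ℂ) {β : ℂ} (hβ : 0 < β.re) :
    Tendsto (fun m : ℕ => cosh ((y + m * β) / 2) / sinh ((y + m * β) / 2) / 2) atTop
      (𝓝 (1 / 2)) := by
  have h := tendsto_exp_neg_add_natCast_mul y hβ
  have h1 := (h.div (h.const_sub 1) (by simp)).add_const (1 / 2 : ℂ)
  rw [zero_div, zero_add] at h1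
  refine h1.congr' ?_
  have h2 : ∀ᶠ m : ℕ in atTop, 0 < (y + m * β).re :=
    (tendsto_natCast_mul_re_atTop y hβ).eventually_gt_atTop 0
  filter_upwards [h2] with m hm
  rw [coth_half_eq (one_sub_exp_neg_ne_zero (shiftPt_ne_zero_of_re_ne_zero hm.ne'))]
  rfl

theorem exp_logOneSubExp {w : ℂ} (hw : ∀ n : ℤ, shiftPt w n ≠ 0) :
    exp (logOneSubExp w) = 1 - exp (-w) :=
  exp_log (one_sub_exp_neg_ne_zero hw)

theorem exp_neg_mul_pow (y β : ℂ) (m : ℕ) :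
    exp (-y) * exp (-β) ^ m = exp (-(y + m * β)) := by
  rw [← Complex.exp_nat_mul, ← Complex.exp_add]
  congr 1
  ring

theorem multipliable_one_sub_mul_pow (z : ℂ) {q : ℂ} (hq : ‖q‖ < 1) :
    Multipliable fun j : ℕ => 1 - z * q ^ j := by
  have h : Summable fun j : ℕ => ‖-(z * q ^ j)‖ := by
    simp only [norm_neg, norm_mul, norm_pow]
    exact (summable_geometric_of_lt_one (norm_nonneg q) hq).mul_left _
  simpa [sub_eq_add_neg] using multipliable_one_add_of_summable h

theorem hasProd_qPochhammerInf (z : ℂ) {q : ℂ} (hq : ‖q‖ < 1) :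
    HasProd (fun j : ℕ => 1 - z * q ^ j) (qPochhammerInf z q) :=
  (multipliable_one_sub_mul_pow z hq).hasProd

theorem qPochhammerInf_eq_mul (z : ℂ) {q : ℂ} (hq : ‖q‖ < 1) :
    qPochhammerInf z q = (1 - z) * qPochhammerInf (z * q) q := by
  have e : (fun j : ℕ => 1 - z * q ^ (j + 1)) = fun j => 1 - z * q * q ^ j :=
    funext fun j => by rw [pow_succ]; ring
  have h1 : Multipliable fun j : ℕ => 1 - z * q ^ (j + 1) := by
    rw [e]; exact multipliable_one_sub_mul_pow (z * q) hq
  have h2 : qPochhammerInf (z * q) q = ∏' j : ℕ, (1 - z * q ^ (j + 1)) := by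
    rw [e, qPochhammerInf]
  have h3 := tprod_eq_zero_mul' (f := fun j : ℕ => 1 - z * q ^ j) h1
  rw [h2, qPochhammerInf, h3, pow_zero, mul_one]

/-- The `n`-th factor of the principal value product, on the explicit branches. -/
noncomputable def gammaFactor (β y : ℂ) (n : ℤ) : ℂ :=
  (Real.sqrt (2 * Real.pi) : ℂ) / Gamma (shiftPt y n / β) *
    quotPow (shiftPt y n) β (shiftPt y n / β - 1 / 2) * exp (-(shiftPt y n / β))

/-- For fixed `n` the corrections telescope, and Stirling's formula evaluates the rest. Only `β /
(12 y_n)` remains outside the absolutely convergent sum. -/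
theorem hasSum_correctedLogFactor_column {y β : ℂ} (hy : 0 < y.re) (hβ : 0 < β.re) (n : ℤ)
    {S : ℂ} (hS : HasSum (fun m : ℕ => correctedLogFactor β y (n, m)) S) :
    gammaFactor β y n = exp (-(S + β / (12 * shiftPt y n))) := by
  have hβ0 : β ≠ 0 := fun h => by simp [h] at hβ
  have hw : 0 < (shiftPt y n).re := by rwa [shiftPt_re]
  have hw0 := shiftPt_ne_zero_of_re_ne_zero hy.ne' n
  have h1 : ∀ M : ℕ, ∑ m ∈ Finset.range M, correctedLogFactor β y (n, m) +
      1 / 12 * (β / shiftPt y n - β / shiftPt (y + M * β) n) =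
      ∑ m ∈ Finset.range M, (((shiftPt y n + m * β) / β + 1 / 2) *
      (log (shiftPt y n + (m + 1 : ℕ) * β) - log (shiftPt y n + m * β)) - 1) := by
    intro M
    induction M with
    | zero => simp
    | succ M ih =>
      rw [Finset.sum_range_succ, Finset.sum_range_succ, ← ih, correctedLogFactor, logFactor]
      simp only [add_natCast_succ_mul, shiftPt_add]
      ring
  have h2 := hS.tendsto_sum_nat.add
    (((tendsto_const_div_shiftPt_add y hβ n β).const_sub (β / shiftPt y n)).const_mul (1 / 12))
  simp only [h1] at h2
  have h3 := tendsto_nhds_unique ((Complex.continuous_exp.tendsto _).comp h2)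
    (tendsto_exp_sum_mul_log_sub_log hw hβ)
  have e : S + β / (12 * shiftPt y n) = S + 1 / 12 * (β / shiftPt y n - 0) := by
    rw [sub_zero]; field_simp
  have hG : Gamma (shiftPt y n / β) ≠ 0 := by
    refine Complex.Gamma_ne_zero fun m hm => ?_
    refine slitPlane_ne_zero (add_natCast_mul_mem_slitPlane hw hβ m) ?_
    rw [div_eq_iff hβ0] at hm
    rw [hm]; ring
  have hs : ((Real.sqrt (2 * Real.pi) : ℝ) : ℂ) ≠ 0 := by
    exact_mod_cast (Real.sqrt_pos.2 Real.two_pi_pos).ne'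
  rw [e, Complex.exp_neg, h3, gammaFactor, quotPow, Complex.exp_neg, Complex.exp_neg]
  have h5 := Complex.exp_ne_zero (shiftPt y n / β)
  have h6 := Complex.exp_ne_zero
    ((shiftPt y n / β - 1 / 2) * (log (shiftPt y n) - log β))
  field_simp

/-- For fixed `m` the logarithmic factors sum unconditionally but the corrections only as principal
values, so the sums are compared along symmetric intervals. -/
theorem hasSum_correctedLogFactor_row {y β : ℂ} (hy : 0 < y.re) (hβ : 0 < β.re) (m : ℕ)
    {S : ℂ} (hS : HasSum (fun n : ℤ => correctedLogFactor β y (n, m)) S) :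
    S = (dilogExp (y + (m + 1 : ℕ) * β) - dilogExp (y + m * β)) / β -
      (logOneSubExp (y + m * β) + logOneSubExp (y + (m + 1 : ℕ) * β)) / 2 -
      β / 12 * (cosh ((y + m * β) / 2) / sinh ((y + m * β) / 2) / 2 -
        cosh ((y + (m + 1 : ℕ) * β) / 2) / sinh ((y + (m + 1 : ℕ) * β) / 2) / 2) := by
  have hβ0 : β ≠ 0 := fun h => by simp [h] at hβ
  have h0 := shiftPt_ne_zero_of_re_ne_zero (re_add_natCast_mul_pos hy hβ m).ne'
  have h1 := shiftPt_ne_zero_of_re_ne_zero (re_add_natCast_mul_pos hy hβ (m + 1)).ne'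
  have h2 := HasSum.symmetricIcc (hasSum_logFactor hβ0 h0 (by rwa [← add_natCast_succ_mul]))
  have h3 := ((hasSum_inv_shiftPt h0).sub (hasSum_inv_shiftPt h1)).mul_left (β / 12)
  have h4 := h2.sub h3
  rw [← add_natCast_succ_mul] at h4
  refine (HasSum.symmetricIcc hS).unique ?_
  convert! h4 using 1
  funext n
  rw [correctedLogFactor]
  ring

/-- The principal value product formula in the right half plane. -/
theorem hasProd_gammaFactor_of_re_pos {y β : ℂ} (hy : 0 < y.re) (hβ : 0 < β.re) :
    HasProd (gammaFactor β y)
      (qPochhammerInf (exp (-y)) (exp (-β)) *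
        exp (dilogExp y / β - logOneSubExp y / 2 - β / 24))
      (SummationFilter.symmetricIcc ℤ) := by
  have hβ0 : β ≠ 0 := fun h => by simp [h] at hβ
  have hsum := summable_correctedLogFactor hy hβ
  set S := ∑' p, correctedLogFactor β y p with hS
  have hcol := hsum.hasSum.prod_fiberwise fun n => (hsum.prod_factor n).hasSum
  have hsum' := hsum.prod_symm
  have hrow := ((Equiv.prodComm ℕ ℤ).hasSum_iff.2 hsum.hasSum).prod_fiberwise
    fun m => (hsum'.prod_factor m).hasSum
  have hfac : ∀ n, gammaFactor β y n =
      exp (-((∑' m : ℕ, correctedLogFactor β y (n, m)) + β / (12 * shiftPt y n))) :=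
    fun n => hasSum_correctedLogFactor_column hy hβ n (hsum.prod_factor n).hasSum
  have hy0 := shiftPt_ne_zero_of_re_ne_zero hy.ne'
  set c : ℕ → ℂ := fun m => cosh ((y + m * β) / 2) / sinh ((y + m * β) / 2) / 2 with hc
  -- The dilogarithms and cotangents telescope in `m`; the averages of neighbouring logarithms add
  -- up to the logarithm of the `q`-product with half-weights at the ends.
  have hpart : ∀ M : ℕ, ∑ m ∈ Finset.range M, (∑' n : ℤ, correctedLogFactor β y (n, m)) =
      (dilogExp (y + M * β) - dilogExp y) / β + logOneSubExp y / 2 -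
      logOneSubExp (y + M * β) / 2 - ∑ m ∈ Finset.range M, logOneSubExp (y + m * β) -
      β / 12 * (c 0 - c M) := by
    intro M
    induction M with
    | zero => simp
    | succ M ih =>
      have hM : ∑' n : ℤ, correctedLogFactor β y (n, M) = _ :=
        hasSum_correctedLogFactor_row hy hβ M (hsum'.prod_factor M).hasSum
      rw [Finset.sum_range_succ, Finset.sum_range_succ, ih, hM]
      simp only [hc]
      ring
  have hlim := hrow.tendsto_sum_nat
  have hexp : Tendsto (fun M : ℕ => exp (-∑ m ∈ Finset.range M,
      (∑' n : ℤ, correctedLogFactor β y (n, m)))) atTop (𝓝 (exp (-S))) :=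
    (Complex.continuous_exp.tendsto _).comp hlim.neg
  have hq : ‖exp (-β)‖ < 1 := norm_exp_neg_lt_one hβ
  have hP := (hasProd_qPochhammerInf (exp (-y)) hq).tendsto_prod_nat
  -- The limit `1 / 2` of `c M` is the origin of `β / 24`.
  have hrest : Tendsto (fun M : ℕ => -(dilogExp (y + M * β) - dilogExp y) / β -
      logOneSubExp y / 2 + logOneSubExp (y + M * β) / 2 + β / 12 * (c 0 - c M)) atTop
      (𝓝 (-(0 - dilogExp y) / β - logOneSubExp y / 2 + 0 / 2 + β / 12 * (c 0 - 1 / 2))) :=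
    ((((((tendsto_dilogExp_add_natCast_mul y hβ).sub_const _).neg).div_const β).sub_const _).add
      ((tendsto_logOneSubExp_add_natCast_mul y hβ).div_const 2)).add
      (((tendsto_coth_add_natCast_mul y hβ).const_sub (c 0)).const_mul (β / 12))
  have hexp' := hP.mul ((Complex.continuous_exp.tendsto _).comp hrest)
  have hSval := tendsto_nhds_unique hexp (hexp'.congr fun M => by
    rw [hpart]
    have e : ∏ j ∈ Finset.range M, (1 - exp (-y) * exp (-β) ^ j) =
        exp (∑ m ∈ Finset.range M, logOneSubExp (y + m * β)) := by
      rw [Complex.exp_sum]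
      refine Finset.prod_congr rfl fun m _ => ?_
      rw [exp_logOneSubExp (shiftPt_ne_zero_of_re_ne_zero (re_add_natCast_mul_pos hy hβ m).ne'),
        exp_neg_mul_pow]
    rw [e, Function.comp, ← Complex.exp_add]
    congr 1
    ring)
  have htot := (HasSum.symmetricIcc hcol).add ((hasSum_inv_shiftPt hy0).mul_left (β / 12))
  have hprod : HasProd (gammaFactor β y)
      (exp (-(S + β / 12 * (cosh (y / 2) / sinh (y / 2) / 2)))) (SummationFilter.symmetricIcc ℤ) := by
    have h1 := (Complex.continuous_exp.tendsto _).comp (Filter.Tendsto.neg htot)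
    refine Filter.Tendsto.congr (fun s => ?_) h1
    simp only [Function.comp]
    rw [← Finset.sum_neg_distrib, Complex.exp_sum]
    refine Finset.prod_congr rfl fun n _ => ?_
    rw [hfac]
    congr 2
    field_simp
  convert! hprod using 1
  rw [neg_add, Complex.exp_add, hSval, mul_assoc, ← Complex.exp_add]
  congr 2
  simp only [hc, Nat.cast_zero, zero_mul, add_zero]
  ring

/-- `Γ(x+1) = xΓ(x)`, with `x` written as `exp (log y_n - log β)` so that the branches match on the
cuts too. -/
theorem gammaFactor_eq_mul_exp_neg_logFactor {y β : ℂ} (hβ : β ≠ 0) {n : ℤ}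
    (hy : shiftPt y n ≠ 0) :
    gammaFactor β y n = gammaFactor β (y + β) n * exp (-logFactor β y n) := by
  have hx : shiftPt (y + β) n / β = shiftPt y n / β + 1 := by
    rw [shiftPt_add]; field_simp
  have hx0 : shiftPt y n / β ≠ 0 := div_ne_zero hy hβ
  have e : shiftPt y n / β = exp (log (shiftPt y n) - log β) := (exp_log_sub_log hy hβ).symm
  rw [gammaFactor, gammaFactor, hx, Complex.Gamma_add_one _ hx0, logFactor, quotPow, quotPow]
  have e2 : (Real.sqrt (2 * Real.pi) : ℂ) / (shiftPt y n / β * Gamma (shiftPt y n / β)) =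
      (Real.sqrt (2 * Real.pi) : ℂ) / Gamma (shiftPt y n / β) *
        exp (-(log (shiftPt y n) - log β)) := by
    rw [Complex.exp_neg, ← e, mul_comm (shiftPt y n / β), ← div_div, div_eq_mul_inv _ (_ / β)]
  rw [e2]
  simp only [mul_assoc, ← Complex.exp_add]
  congr 2
  ring

/-- The principal value product formula, on the explicit branches. -/
theorem hasProd_gammaFactor {y β : ℂ} (hβ : 0 < β.re) (hy : ∀ n : ℤ, shiftPt y n ≠ 0) :
    HasProd (gammaFactor β y)
      (qPochhammerInf (exp (-y)) (exp (-β)) *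
        exp (dilogExp y / β - logOneSubExp y / 2 - β / 24))
      (SummationFilter.symmetricIcc ℤ) := by
  have hβ0 : β ≠ 0 := fun h => by simp [h] at hβ
  have hq : ‖exp (-β)‖ < 1 := norm_exp_neg_lt_one hβ
  -- Some `y + Mβ` lies in the right half-plane, and each step from `y + β` back to `y` multiplies
  -- by an unconditionally convergent product.
  obtain ⟨M, hM⟩ := ((tendsto_natCast_mul_re_atTop y hβ).eventually_gt_atTop 0).exists
  induction M generalizing y with
  | zero => exact hasProd_gammaFactor_of_re_pos (by simpa using hM) hβ
  | succ M ih =>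
    have hqy : qPochhammerInf (exp (-y)) (exp (-β)) =
        (1 - exp (-y)) * qPochhammerInf (exp (-(y + β))) (exp (-β)) := by
      rw [qPochhammerInf_eq_mul _ hq, neg_add, Complex.exp_add]
    by_cases hyβ : ∀ n : ℤ, shiftPt (y + β) n ≠ 0
    · have h1 := ih hyβ (by rw [add_natCast_succ_mul] at hM; convert! hM using 2; ring)
      have h2 := HasProd.symmetricIcc (HasSum.cexp (hasSum_logFactor hβ0 hy hyβ).neg)
      have h3 := h1.mul h2
      convert! h3 using 1
      · funext n
        exact gammaFactor_eq_mul_exp_neg_logFactor hβ0 (hy n)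
      · rw [hqy, ← exp_logOneSubExp hy, mul_comm (exp (logOneSubExp y)), mul_assoc, mul_assoc,
          ← Complex.exp_add, ← Complex.exp_add]
        congr 2
        ring
    -- If `y + β` is in `2πiℤ`, the step formula is unavailable, but both sides vanish: the
    -- `q`-product has the factor `1 - e^{-(y+β)} = 0`, and some `x_n = -1`. There `Gamma (-1) = 0`
    -- and `a / 0 = 0` give the value intended by the entire function `1 / Γ`.
    · push Not at hyβ
      obtain ⟨n, hn⟩ := hyβ
      have h1 : exp (-(y + β)) = 1 := by
        by_contra h
        exact exp_neg_ne_one_iff.1 h n hn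
      have h2 : qPochhammerInf (exp (-y)) (exp (-β)) = 0 := by
        rw [hqy, h1, qPochhammerInf_eq_mul _ hq]; simp
      rw [h2, zero_mul]
      refine hasProd_zero_of_exists_eq_zero ⟨n, ?_⟩
      have h3 : shiftPt y n / β = -1 := by
        rw [shiftPt_add] at hn
        rw [div_eq_iff hβ0]
        linear_combination hn
      rw [gammaFactor, h3]
      have := Complex.Gamma_neg_nat_eq_zero 1
      rw [Nat.cast_one] at this
      rw [this]
      simp

end DoubleSum

/-! ### Analytic continuation along paths -/

section Continuation

open Complex

variable {a b : ℂ} {γ : Path a b} {f g : ℂ → ℂ} {F G : unitInterval → ℂ → ℂ}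

theorem IsAnalyticContinuationAlong.congr (hF : IsAnalyticContinuationAlong γ f F)
    (h : f =ᶠ[𝓝 a] g) : IsAnalyticContinuationAlong γ g F :=
  ⟨hF.1.trans h, hF.2⟩

/-- Analytic continuation along a path is unique. -/
theorem IsAnalyticContinuationAlong.eventuallyEq (hF : IsAnalyticContinuationAlong γ f F)
    (hG : IsAnalyticContinuationAlong γ f G) (t : unitInterval) : F t =ᶠ[𝓝 (γ t)] G t := by
  have hcont : ∀ t, Tendsto γ (𝓝 t) (𝓝 (γ t)) := fun t => γ.continuous.tendsto t
  set S : Set unitInterval := {t | F t =ᶠ[𝓝 (γ t)] G t} with hS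
  have hopen : IsOpen S := by
    rw [isOpen_iff_mem_nhds]
    intro t ht
    have h1 : ∀ᶠ w in 𝓝 (γ t), F t =ᶠ[𝓝 w] G t := eventually_eventually_nhds.2 ht
    filter_upwards [hF.2.2 t, hG.2.2 t, (hcont t).eventually h1] with s h2 h3 h4
    exact h2.trans (h4.trans h3.symm)
  have hclosed : IsClosed S := by
    rw [← isOpen_compl_iff, isOpen_iff_mem_nhds]
    intro t ht
    -- Isolated zeros: if the germs differ at `t`, the difference has no zero near `γ t` except
    -- perhaps `γ t` itself. Equal germs at a nearby `s` would then make a whole neighbourhood of `γ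
    -- s` equal to one point.
    have han := (hF.2.1 t).sub (hG.2.1 t)
    rcases han.eventually_eq_zero_or_eventually_ne_zero with h | h
    · exact absurd (h.mono fun w hw => sub_eq_zero.1 hw) ht
    · rw [eventually_nhdsWithin_iff] at h
      have h1 := (hcont t).eventually (eventually_eventually_nhds.2 h)
      filter_upwards [hF.2.2 t, hG.2.2 t, h1] with s h2 h3 h4 hs
      have h5 : F t =ᶠ[𝓝 (γ s)] G t := h2.symm.trans (Filter.EventuallyEq.trans hs h3)
      have h6 : ∀ᶠ w in 𝓝 (γ s), w = γ t := by
        filter_upwards [h4, h5] with w h7 h8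
        by_contra hne
        exact h7 hne (by simpa using sub_eq_zero.2 h8)
      have h9 : γ s = γ t := h6.self_of_nhds
      rw [h9] at h6
      have h10 : ∀ᶠ w in 𝓝[≠] (γ t), False := by
        rw [eventually_nhdsWithin_iff]
        filter_upwards [h6] with w h11 h12 using h12 h11
      exact (NeBot.ne inferInstance) (eventually_false_iff_eq_bot.1 h10)
  have h0 : (0 : unitInterval) ∈ S := by
    change F 0 =ᶠ[𝓝 (γ 0)] G 0
    rw [γ.source]
    exact hF.1.trans hG.1.symm
  have huniv : S = Set.univ := IsClopen.eq_univ ⟨hclosed, hopen⟩ ⟨0, h0⟩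
  have : t ∈ S := huniv ▸ Set.mem_univ t
  exact this

/-- By uniqueness, any continuation given as a hypothesis may be traded for one constructed
explicitly. -/
theorem ContinuesTo.eq_of_isAnalyticContinuationAlong {v : ℂ} (h : ContinuesTo γ f v)
    (hF : IsAnalyticContinuationAlong γ f F) : v = F 1 b := by
  obtain ⟨G, hG, rfl⟩ := h
  have := (hG.eventuallyEq hF 1).self_of_nhds
  rwa [γ.target] at this

theorem isAnalyticContinuationAlong_const (h : ∀ t, AnalyticAt ℂ f (γ t)) :
    IsAnalyticContinuationAlong γ f fun _ => f :=
  ⟨EventuallyEq.rfl, h, fun _ => Eventually.of_forall fun _ => EventuallyEq.rfl⟩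

theorem IsAnalyticContinuationAlong.add (hF : IsAnalyticContinuationAlong γ f F)
    (hG : IsAnalyticContinuationAlong γ g G) :
    IsAnalyticContinuationAlong γ (fun w => f w + g w) fun t w => F t w + G t w := by
  refine ⟨hF.1.add hG.1, fun t => (hF.2.1 t).add (hG.2.1 t), fun t => ?_⟩
  filter_upwards [hF.2.2 t, hG.2.2 t] with s h1 h2 using h1.add h2

theorem IsAnalyticContinuationAlong.mul (hF : IsAnalyticContinuationAlong γ f F)
    (hG : IsAnalyticContinuationAlong γ g G) :
    IsAnalyticContinuationAlong γ (fun w => f w * g w) fun t w => F t w * G t w := by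
  refine ⟨hF.1.mul hG.1, fun t => (hF.2.1 t).mul (hG.2.1 t), fun t => ?_⟩
  filter_upwards [hF.2.2 t, hG.2.2 t] with s h1 h2 using h1.mul h2

theorem IsAnalyticContinuationAlong.sub (hF : IsAnalyticContinuationAlong γ f F)
    (hG : IsAnalyticContinuationAlong γ g G) :
    IsAnalyticContinuationAlong γ (fun w => f w - g w) fun t w => F t w - G t w := by
  refine ⟨hF.1.sub hG.1, fun t => (hF.2.1 t).sub (hG.2.1 t), fun t => ?_⟩
  filter_upwards [hF.2.2 t, hG.2.2 t] with s h1 h2 using h1.sub h2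

theorem IsAnalyticContinuationAlong.cexp (hF : IsAnalyticContinuationAlong γ f F) :
    IsAnalyticContinuationAlong γ (fun w => exp (f w)) fun t w => exp (F t w) := by
  refine ⟨hF.1.fun_comp exp, fun t => (hF.2.1 t).cexp, fun t => ?_⟩
  filter_upwards [hF.2.2 t] with s h1 using h1.fun_comp exp

theorem IsAnalyticContinuationAlong.sum {ι : Type*} (s : Finset ι) {f : ι → ℂ → ℂ}
    {F : ι → unitInterval → ℂ → ℂ} (h : ∀ i, IsAnalyticContinuationAlong γ (f i) (F i)) :
    IsAnalyticContinuationAlong γ (fun w => ∑ i ∈ s, f i w) fun t w => ∑ i ∈ s, F i t w := by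
  classical
  induction s using Finset.induction_on with
  | empty =>
    simp only [Finset.sum_empty]
    exact isAnalyticContinuationAlong_const fun t => analyticAt_const
  | insert i s hi ih =>
    simp only [Finset.sum_insert hi]
    exact (h i).add ih

theorem IsAnalyticContinuationAlong.comp_add_const {c : ℂ} {F : unitInterval → ℂ → ℂ}
    (h : IsAnalyticContinuationAlong (γ.map (continuous_add_const c)) f F) :
    IsAnalyticContinuationAlong γ (fun w => f (w + c)) fun t w => F t (w + c) := by
  have hc : ∀ z : ℂ, Tendsto (fun w => w + c) (𝓝 z) (𝓝 (z + c)) := fun z =>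
    (continuous_add_const c).tendsto z
  refine ⟨h.1.comp_tendsto (hc a), fun t => ?_, fun t => ?_⟩
  · have h1 : AnalyticAt ℂ (F t) (γ t + c) := h.2.1 t
    exact h1.fun_comp (f := fun w => w + c) (analyticAt_id.add analyticAt_const)
  · filter_upwards [h.2.2 t] with s hs
    exact EventuallyEq.comp_tendsto hs (hc (γ s))

/-- A branch of the logarithm continues along each path that avoids its branch point. -/
theorem exists_isAnalyticContinuationAlong_log (γ : Path a b) (c : ℂ) (ha : a + c ∈ slitPlane)
    (hγ : ∀ t, γ t + c ≠ 0) :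
    ∃ F, IsAnalyticContinuationAlong γ (fun w => log (w + c)) F := by
  -- The lift of `γ t + c` through the covering `exp` gives the continued value `l t`; adding `log`
  -- of a quotient near 1 extends it to a germ.
  obtain ⟨l, hl, hl0⟩ := isCoveringMap_exp.exists_path_lifts
    ⟨fun t => ⟨γ t + c, hγ t⟩, (γ.continuous.add continuous_const).subtype_mk _⟩
    (log (a + c)) (by
      ext
      simp [exp_log (slitPlane_ne_zero ha)])
  have hexp : ∀ t, exp (l t) = γ t + c := fun t => congrArg Subtype.val (congrFun hl t)
  have hlog : ∀ t, Tendsto (fun w => log ((w + c) / (γ t + c))) (𝓝 (γ t)) (𝓝 0) := by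
    intro t
    have h1 : Tendsto (fun w => (w + c) / (γ t + c)) (𝓝 (γ t)) (𝓝 ((γ t + c) / (γ t + c))) :=
      ((continuous_add_const c).tendsto _).div_const _
    have h2 := Tendsto.clog h1 (by rw [div_self (hγ t)]; exact one_mem_slitPlane)
    rwa [div_self (hγ t), log_one] at h2
  have hsmall : ∀ t, ∀ᶠ w in 𝓝 (γ t), ‖log ((w + c) / (γ t + c))‖ < Real.pi / 2 := fun t => by
    have := (hlog t).norm
    rw [norm_zero] at this
    exact this.eventually_lt_const (by positivity)
  have hne : ∀ t, ∀ᶠ w in 𝓝 (γ t), w + c ≠ 0 := fun t =>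
    (continuous_add_const c).continuousAt.eventually_ne (hγ t)
  have key : ∀ z : ℂ, ‖z‖ < Real.pi → log (exp z) = z := fun z hz => by
    have := (abs_lt.1 ((abs_im_le_norm z).trans_lt hz))
    exact log_exp this.1 this.2.le
  refine ⟨fun t w => l t + log ((w + c) / (γ t + c)), ?_, fun t => ?_, fun t => ?_⟩
  · have h1 : Tendsto (fun w => log (w + c) - log (a + c)) (𝓝 a) (𝓝 0) := by
      have : ContinuousAt (fun w => log (w + c) - log (a + c)) a :=
        (ContinuousAt.clog (f := fun w => w + c) (by fun_prop) ha).sub continuousAt_const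
      simpa using this.tendsto
    have h2 := h1.norm
    rw [norm_zero] at h2
    have h3 := hne 0
    rw [γ.source] at h3
    filter_upwards [h2.eventually_lt_const Real.pi_pos, h3] with w hw hw0
    have h4 := key _ hw
    rw [Complex.exp_sub, exp_log hw0, exp_log (slitPlane_ne_zero ha)] at h4
    rw [hl0, γ.source, h4]
    ring
  · refine analyticAt_const.add (AnalyticAt.clog ?_ ?_)
    · exact (analyticAt_id.add analyticAt_const).div analyticAt_const (hγ t)
    · rw [div_self (hγ t)]; exact one_mem_slitPlane
  · have h1 : Tendsto (fun s => l s - l t) (𝓝 t) (𝓝 0) := by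
      have : Continuous fun s => l s - l t := l.continuous.sub continuous_const
      simpa using this.tendsto t
    have h2 := h1.norm
    rw [norm_zero] at h2
    -- Two bounds `π / 2` keep the sum of norm less than `π`, where `log` inverts `exp`.
    filter_upwards [h2.eventually_lt_const (show 0 < Real.pi / 2 by positivity)] with s hs
    filter_upwards [hsmall s, hne s] with w hw hw0
    have h3 := key (l s - l t + log ((w + c) / (γ s + c)))
      ((norm_add_le _ _).trans_lt (by linarith))
    rw [Complex.exp_add, Complex.exp_sub, exp_log (div_ne_zero hw0 (hγ s)), hexp, hexp] at h3
    have h4 : (γ s + c) / (γ t + c) * ((w + c) / (γ s + c)) = (w + c) / (γ t + c) := by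
      have := hγ s
      have := hγ t
      field_simp
    rw [h4] at h3
    rw [h3]
    ring

theorem exists_isAnalyticContinuationAlong_log_shiftPt (γ : Path a b) (ha : 0 < a.re) (n : ℤ)
    (hγ : ∀ t, shiftPt (γ t) n ≠ 0) :
    ∃ F, IsAnalyticContinuationAlong γ (fun w => log (shiftPt w n)) F :=
  exists_isAnalyticContinuationAlong_log γ _ (shiftPt_mem_slitPlane_of_re_pos ha n) hγ

theorem exists_path_subset_ball (γ : Path a b) : ∃ r : ℝ, ∀ t, ‖γ t‖ ≤ r := by
  obtain ⟨r, hr⟩ := (isCompact_range γ.continuous).isBounded.exists_norm_le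
  exact ⟨r, fun t => hr _ ⟨t, rfl⟩⟩

/-- Simultaneous continuation of the logarithms, the dilogarithm and the square root. -/
theorem exists_isAnalyticContinuationAlong_dilogExp {N : ℕ} (γ : Path a b) (ha : 0 < a.re)
    (hγ : ∀ t, ∀ n : ℤ, shiftPt (γ t) n ≠ 0)
    (hN : ∀ t, γ t ∈ Metric.ball (0 : ℂ) (discRadius N)) :
    ∃ (κ : ℤ → ℂ) (Λ : ℤ → unitInterval → ℂ → ℂ) (Fd Fr : unitInterval → ℂ → ℂ),
      (∀ n ∉ Finset.Icc (-(N : ℤ)) N, κ n = 0) ∧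
      (∀ n, IsAnalyticContinuationAlong γ (fun w => log (shiftPt w n)) (Λ n)) ∧
      (∀ n, Λ n 1 b = log (shiftPt b n) + κ n) ∧
      IsAnalyticContinuationAlong γ dilogExp Fd ∧
      Fd 1 b = dilogExp b + ∑ n ∈ Finset.Icc (-(N : ℤ)) N, shiftPt b n * κ n ∧
      IsAnalyticContinuationAlong γ (fun w => exp (logOneSubExp w / 2)) Fr ∧
      Fr 1 b = exp ((logOneSubExp b + ∑ n ∈ Finset.Icc (-(N : ℤ)) N, κ n) / 2) := by
  obtain ⟨A, q, hA, hq, hL, hD⟩ := exists_regularised_log_dilog N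
  have hball := Metric.isOpen_ball (x := (0 : ℂ)) (ε := discRadius N)
  have hAan : ∀ t, AnalyticAt ℂ A (γ t) := fun t =>
    DifferentiableOn.analyticAt (s := Metric.ball 0 (discRadius N))
      (fun w hw => (hA w hw).differentiableAt.differentiableWithinAt) (hball.mem_nhds (hN t))
  have hqan : ∀ t, AnalyticAt ℂ q (γ t) := fun t =>
    DifferentiableOn.analyticAt (s := Metric.ball 0 (discRadius N))
      (fun w hw => (hq w hw).differentiableAt.differentiableWithinAt) (hball.mem_nhds (hN t))
  have hsan : ∀ (n : ℤ) (z : ℂ), AnalyticAt ℂ (fun w => shiftPt w n) z := fun n z =>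
    analyticAt_id.add analyticAt_const
  have haB : a ∈ Metric.ball (0 : ℂ) (discRadius N) := by simpa using hN 0
  have hbB : b ∈ Metric.ball (0 : ℂ) (discRadius N) := by simpa using hN 1
  have hb0 : ∀ n : ℤ, shiftPt b n ≠ 0 := by simpa using hγ 1
  have hnear : ∀ᶠ w in 𝓝 a, w ∈ Metric.ball (0 : ℂ) (discRadius N) ∧ ∀ n : ℤ, shiftPt w n ≠ 0 := by
    filter_upwards [hball.mem_nhds haB,
      (isOpen_lt continuous_const continuous_re).mem_nhds ha] with w h1 h2
    exact ⟨h1, shiftPt_ne_zero_of_re_ne_zero (ne_of_gt h2)⟩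
  choose Λ hΛ using fun n => exists_isAnalyticContinuationAlong_log_shiftPt γ ha n fun t => hγ t n
  -- `A` and `q` are single-valued on the disc, so the increments of finitely many logarithms carry
  -- all the monodromy. That they lie in `2πiℤ` is never needed.
  refine ⟨fun n => Λ n 1 b - log (shiftPt b n), Λ,
    fun t w => A w + ∑ n ∈ Finset.Icc (-(N : ℤ)) N, (shiftPt w n * Λ n t w - shiftPt w n),
    fun t w => exp ((q w + ∑ n ∈ Finset.Icc (-(N : ℤ)) N, Λ n t w) * (1 / 2)),
    fun n hn => ?_, hΛ, fun n => by ring, ?_, ?_, ?_, ?_⟩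
  · rw [sub_eq_zero]
    -- For `|n| > N` the point `shiftPt w n` stays off the real axis on the disc, so the principal
    -- branch is its own continuation.
    have h1 : IsAnalyticContinuationAlong γ (fun w => log (shiftPt w n))
        fun _ w => log (shiftPt w n) :=
      isAnalyticContinuationAlong_const fun t =>
        (hsan n _).clog (Or.inr (im_shiftPt_ne_zero (hN t) hn))
    have h2 := ((hΛ n).eventuallyEq h1 1).self_of_nhds
    rwa [γ.target] at h2
  · refine ((isAnalyticContinuationAlong_const hAan).add (IsAnalyticContinuationAlong.sum _
      fun n => ((isAnalyticContinuationAlong_const fun t => hsan n _).mul (hΛ n)).sub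
        (isAnalyticContinuationAlong_const fun t => hsan n _))).congr ?_
    filter_upwards [hnear] with w hw
    exact (hD w hw.1 hw.2).symm
  · beta_reduce
    rw [hD b hbB hb0, add_assoc, ← Finset.sum_add_distrib]
    congr 1
    refine Finset.sum_congr rfl fun n _ => ?_
    ring
  · refine (((isAnalyticContinuationAlong_const hqan).add
      (IsAnalyticContinuationAlong.sum _ hΛ)).mul
      (isAnalyticContinuationAlong_const (f := fun _ => (1 / 2 : ℂ))
        fun t => analyticAt_const)).cexp.congr ?_
    filter_upwards [hnear] with w hw
    rw [hL w hw.1 hw.2, mul_one_div]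
  · beta_reduce
    rw [hL b hbB hb0, add_assoc, ← Finset.sum_add_distrib, mul_one_div]
    congr 3
    refine Finset.sum_congr rfl fun n _ => ?_
    ring

/-- Both arguments lie in `(-π/2, π/2)`, so their difference needs no multiple of `2π`. This
identifies the explicit branches with principal powers at the start of the path. -/
theorem log_div_of_re_pos {u v : ℂ} (hu : 0 < u.re) (hv : 0 < v.re) :
    log (u / v) = log u - log v := by
  have hu0 : u ≠ 0 := fun h => by simp [h] at hu
  have hv0 : v ≠ 0 := fun h => by simp [h] at hv
  have h1 := abs_lt.1 (abs_arg_lt_pi_div_two_iff.2 (Or.inl hu))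
  have h2 := abs_lt.1 (abs_arg_lt_pi_div_two_iff.2 (Or.inl hv))
  rw [← exp_log_sub_log hu0 hv0, log_exp]
  · rw [sub_im, log_im, log_im]; linarith
  · rw [sub_im, log_im, log_im]; linarith

theorem one_sub_exp_neg_cpow_half {w : ℂ} (hw : ∀ n : ℤ, shiftPt w n ≠ 0) :
    (1 - exp (-w)) ^ (1 / 2 : ℂ) = exp (logOneSubExp w / 2) := by
  rw [cpow_def_of_ne_zero (one_sub_exp_neg_ne_zero hw), logOneSubExp]
  congr 1
  ring

theorem hasProd_exp_of_notMem_eq_zero {s : Finset ℤ} {u : ℤ → ℂ} (hu : ∀ n ∉ s, u n = 0) :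
    HasProd (fun n => exp (u n)) (exp (∑ n ∈ s, u n)) := by
  rw [Complex.exp_sum]
  exact hasProd_prod_of_ne_finset_one fun n hn => by rw [hu n hn, Complex.exp_zero]

end Continuation

/-! ### The two product formulas along paths -/

section PathIdentities

open Complex

theorem hasProd_gammaFactor_of_continuesTo {β a y : ℂ} (hβ : 0 < β.re) (γ : Path a y)
    (ha : 0 < a.re) (hγ : ∀ t, ∀ n : ℤ, shiftPt (γ t) n ≠ 0) {d r : ℂ} {p : ℤ → ℂ}
    (hd : ContinuesTo γ (fun w => dilog (exp (-w))) d)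
    (hr : ContinuesTo γ (fun w => (1 - exp (-w)) ^ (1 / 2 : ℂ)) r)
    (hp : ∀ n : ℤ, ContinuesTo γ (fun w => (shiftPt w n / β) ^ (shiftPt w n / β - 1 / 2)) (p n)) :
    ∃ P : ℂ, HasProd (fun n : ℤ => (Real.sqrt (2 * Real.pi) : ℂ) / Gamma (shiftPt y n / β) * p n *
        exp (-(shiftPt y n / β))) P (SummationFilter.symmetricIcc ℤ) ∧
      qPochhammerInf (exp (-y)) (exp (-β)) = r * exp (β / 24 - d / β) * P := by
  have hβ0 : β ≠ 0 := fun h => by simp [h] at hβ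
  have hy : ∀ n : ℤ, shiftPt y n ≠ 0 := by simpa using hγ 1
  obtain ⟨ρ, hρ⟩ := exists_path_subset_ball γ
  obtain ⟨N, hN⟩ := exists_mem_ball_discRadius ρ
  obtain ⟨κ, Λ, Fd, Fr, hκ, hΛ, hΛ1, hFd, hFd1, hFr, hFr1⟩ :=
    exists_isAnalyticContinuationAlong_dilogExp γ ha hγ fun t => hN _ (hρ t)
  have hnear : ∀ᶠ w in 𝓝 a, 0 < w.re := (isOpen_lt continuous_const continuous_re).mem_nhds ha
  have hs : ∀ (n : ℤ) (z : ℂ), AnalyticAt ℂ (fun w => shiftPt w n / β - 1 / 2) z := fun n z =>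
    ((analyticAt_id.add analyticAt_const).div analyticAt_const hβ0).sub analyticAt_const
  have hd1 : d = _ := (hd.eq_of_isAnalyticContinuationAlong hFd).trans hFd1
  have hr1 : r = _ := (hr.eq_of_isAnalyticContinuationAlong (hFr.congr (by
    filter_upwards [hnear] with w hw
    exact (one_sub_exp_neg_cpow_half (shiftPt_ne_zero_of_re_ne_zero (ne_of_gt hw))).symm))).trans
      hFr1
  have hp1 : ∀ n, p n = exp ((log (shiftPt y n) + κ n - log β) * (shiftPt y n / β - 1 / 2)) := by
    intro n
    have h1 := (((hΛ n).sub (isAnalyticContinuationAlong_const (f := fun _ => log β)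
      fun t => analyticAt_const)).mul (isAnalyticContinuationAlong_const fun t => hs n (γ t))).cexp
    refine ((hp n).eq_of_isAnalyticContinuationAlong (h1.congr ?_)).trans ?_
    · filter_upwards [hnear] with w hw
      have hw0 := shiftPt_ne_zero_of_re_ne_zero (ne_of_gt hw) n
      rw [cpow_def_of_ne_zero (div_ne_zero hw0 hβ0),
        log_div_of_re_pos (by rwa [shiftPt_re]) hβ]
    · rw [hΛ1]
  have hprod := (hasProd_gammaFactor hβ hy).mul (HasProd.symmetricIcc
    (hasProd_exp_of_notMem_eq_zero (s := Finset.Icc (-(N : ℤ)) N)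
      (u := fun n => κ n * (shiftPt y n / β - 1 / 2)) fun n hn => by rw [hκ n hn, zero_mul]))
  have hterm : (fun n : ℤ => (Real.sqrt (2 * Real.pi) : ℂ) / Gamma (shiftPt y n / β) * p n *
      exp (-(shiftPt y n / β))) = fun n => gammaFactor β y n *
        exp (κ n * (shiftPt y n / β - 1 / 2)) := by
    funext n
    have e : p n = quotPow (shiftPt y n) β (shiftPt y n / β - 1 / 2) *
        exp (κ n * (shiftPt y n / β - 1 / 2)) := by
      rw [hp1, quotPow, ← Complex.exp_add]
      congr 1
      ring
    rw [gammaFactor, e]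
    ring
  rw [hterm]
  refine ⟨_, hprod, ?_⟩
  -- The change in the exponents of the powers splits into the change of the dilogarithm over `β`
  -- minus that of the exponent of the square root; these cancel.
  have e : ∑ n ∈ Finset.Icc (-(N : ℤ)) N, κ n * (shiftPt y n / β - 1 / 2) =
      (∑ n ∈ Finset.Icc (-(N : ℤ)) N, shiftPt y n * κ n) / β -
        (∑ n ∈ Finset.Icc (-(N : ℤ)) N, κ n) / 2 := by
    rw [Finset.sum_div, Finset.sum_div, ← Finset.sum_sub_distrib]
    exact Finset.sum_congr rfl fun n _ => by ring
  rw [e, hd1, hr1, mul_comm (qPochhammerInf _ _), ← mul_assoc, mul_right_comm, ← mul_assoc,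
    ← Complex.exp_add, ← Complex.exp_add, ← Complex.exp_add]
  conv_lhs => rw [← one_mul (qPochhammerInf _ _), ← Complex.exp_zero]
  congr 2
  ring

theorem hasProd_exp_logFactor_of_continuesTo {β a y : ℂ} (hβ : 0 < β.re) (γ : Path a y)
    (ha : 0 < a.re) (hγ : ∀ t, ∀ n : ℤ, shiftPt (γ t) n ≠ 0)
    (hγβ : ∀ t, ∀ n : ℤ, shiftPt (γ t + β) n ≠ 0) {d₀ d₁ r₀ r₁ : ℂ} {p : ℤ → ℂ}
    (hd₀ : ContinuesTo γ (fun w => dilog (exp (-w))) d₀)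
    (hd₁ : ContinuesTo γ (fun w => dilog (exp (-w - β))) d₁)
    (hr₀ : ContinuesTo γ (fun w => (1 - exp (-w)) ^ (1 / 2 : ℂ)) r₀)
    (hr₁ : ContinuesTo γ (fun w => (1 - exp (-w - β)) ^ (1 / 2 : ℂ)) r₁)
    (hp : ∀ n : ℤ, ContinuesTo γ
      (fun w => (1 + β / shiftPt w n) ^ (shiftPt w n / β + 1 / 2)) (p n)) :
    HasProd (fun n : ℤ => exp (-1) * p n) (exp ((d₁ - d₀) / β) / (r₀ * r₁)) := by
  have hβ0 : β ≠ 0 := fun h => by simp [h] at hβ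
  have hy : ∀ n : ℤ, shiftPt y n ≠ 0 := by simpa using hγ 1
  have hyβ : ∀ n : ℤ, shiftPt (y + β) n ≠ 0 := by simpa using hγβ 1
  obtain ⟨ρ, hρ⟩ := exists_path_subset_ball γ
  obtain ⟨N, hN⟩ := exists_mem_ball_discRadius (ρ + ‖β‖)
  have haβ : 0 < (a + β).re := by rw [add_re]; exact add_pos ha hβ
  obtain ⟨κ, Λ, Fd, Fr, hκ, hΛ, hΛ1, hFd, hFd1, hFr, hFr1⟩ :=
    exists_isAnalyticContinuationAlong_dilogExp γ ha hγ
      fun t => hN _ ((hρ t).trans (le_add_of_nonneg_right (norm_nonneg β)))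
  obtain ⟨κ', Λ', Fd', Fr', hκ', hΛ', hΛ1', hFd', hFd1', hFr', hFr1'⟩ :=
    exists_isAnalyticContinuationAlong_dilogExp (γ.map (continuous_add_const β)) haβ hγβ
      fun t => hN _ ((norm_add_le _ _).trans (add_le_add_left (hρ t) ‖β‖))
  have hnear : ∀ᶠ w in 𝓝 a, 0 < w.re := (isOpen_lt continuous_const continuous_re).mem_nhds ha
  have hs : ∀ (n : ℤ) (z : ℂ), AnalyticAt ℂ (fun w => shiftPt w n / β + 1 / 2) z := fun n z =>
    ((analyticAt_id.add analyticAt_const).div analyticAt_const hβ0).add analyticAt_const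
  have hneg : ∀ w : ℂ, -w - β = -(w + β) := fun w => by ring
  simp only [hneg] at hd₁ hr₁
  have hd₀' : d₀ = _ := (hd₀.eq_of_isAnalyticContinuationAlong hFd).trans hFd1
  have hd₁' : d₁ = _ := (hd₁.eq_of_isAnalyticContinuationAlong hFd'.comp_add_const).trans hFd1'
  have hr₀' : r₀ = _ := (hr₀.eq_of_isAnalyticContinuationAlong (hFr.congr (by
    filter_upwards [hnear] with w hw
    exact (one_sub_exp_neg_cpow_half (shiftPt_ne_zero_of_re_ne_zero (ne_of_gt hw))).symm))).trans
      hFr1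
  have hr₁' : r₁ = _ := (hr₁.eq_of_isAnalyticContinuationAlong (hFr'.comp_add_const.congr (by
    filter_upwards [hnear] with w hw
    have hw' : 0 < (w + β).re := by rw [add_re]; exact add_pos hw hβ
    exact (one_sub_exp_neg_cpow_half (shiftPt_ne_zero_of_re_ne_zero (ne_of_gt hw'))).symm))).trans
      hFr1'
  have hp1 : ∀ n, p n = exp ((log (shiftPt (y + β) n) + κ' n - (log (shiftPt y n) + κ n)) *
      (shiftPt y n / β + 1 / 2)) := by
    intro n
    have h1 := (((hΛ' n).comp_add_const.sub (hΛ n)).mul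
      (isAnalyticContinuationAlong_const fun t => hs n (γ t))).cexp
    refine ((hp n).eq_of_isAnalyticContinuationAlong (h1.congr ?_)).trans ?_
    · filter_upwards [hnear] with w hw
      have hw' : 0 < (w + β).re := by rw [add_re]; exact add_pos hw hβ
      have hw0 := shiftPt_ne_zero_of_re_ne_zero (ne_of_gt hw) n
      have hw0' := shiftPt_ne_zero_of_re_ne_zero (ne_of_gt hw') n
      have e : 1 + β / shiftPt w n = shiftPt (w + β) n / shiftPt w n := by
        rw [shiftPt_add]; field_simp
      rw [e, cpow_def_of_ne_zero (div_ne_zero hw0' hw0),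
        log_div_of_re_pos (by rwa [shiftPt_re]) (by rwa [shiftPt_re])]
    · rw [hΛ1, hΛ1']
  have hprod := (hasSum_logFactor hβ0 hy hyβ).cexp.mul
    (hasProd_exp_of_notMem_eq_zero (s := Finset.Icc (-(N : ℤ)) N)
      (u := fun n => (κ' n - κ n) * (shiftPt y n / β + 1 / 2))
      fun n hn => by rw [hκ n hn, hκ' n hn, sub_zero, zero_mul])
  convert hprod using 1
  · funext n
    rw [hp1, Function.comp_apply, logFactor, ← Complex.exp_add, ← Complex.exp_add]
    congr 1
    ring
  · rw [hd₀', hd₁', hr₀', hr₁', ← Complex.exp_add, ← Complex.exp_add, ← Complex.exp_sub]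
    congr 1
    -- For the terms with `κ'` one uses `x_n + 1/2 = (y_n + β)/β - 1/2`.
    have e : ∑ n ∈ Finset.Icc (-(N : ℤ)) N, (κ' n - κ n) * (shiftPt y n / β + 1 / 2) =
        (∑ n ∈ Finset.Icc (-(N : ℤ)) N, shiftPt (y + β) n * κ' n -
          ∑ n ∈ Finset.Icc (-(N : ℤ)) N, shiftPt y n * κ n) / β -
        (∑ n ∈ Finset.Icc (-(N : ℤ)) N, κ' n + ∑ n ∈ Finset.Icc (-(N : ℤ)) N, κ n) / 2 := by
      rw [← Finset.sum_sub_distrib, ← Finset.sum_add_distrib, Finset.sum_div, Finset.sum_div,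
        ← Finset.sum_sub_distrib]
      refine Finset.sum_congr rfl fun n _ => ?_
      rw [shiftPt_add]
      field_simp
      ring
    rw [e]
    ring

end PathIdentities

/-! ### Assembly of the theorem -/

theorem mainTheorem5 (β : ℂ) (hβ : 0 < β.re) :
    -- the removed factor: principal value partial fractions of `coth`
    (∀ y : ℂ, (∀ n : ℤ, shiftPt y n ≠ 0) →
      HasSum (fun n : ℤ => β / (12 * shiftPt y n))
        (β * (Complex.cosh (y / 2) / Complex.sinh (y / 2)) / 24)
        (SummationFilter.symmetricIcc ℤ)) ∧
    -- the identity for every `y ∉ 2πiℤ`, branches cut along `2πiℤ + ℝ_{≤ 0}`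
    (∀ y : ℂ, (∀ n : ℤ, shiftPt y n ≠ 0) →
      ∃ P : ℂ,
        HasProd (fun n : ℤ =>
            (Real.sqrt (2 * Real.pi) : ℂ) / Complex.Gamma (shiftPt y n / β) *
              quotPow (shiftPt y n) β (shiftPt y n / β - 1 / 2) *
              Complex.exp (-(shiftPt y n / β))) P (SummationFilter.symmetricIcc ℤ) ∧
        qPochhammerInf (Complex.exp (-y)) (Complex.exp (-β)) =
          (1 - Complex.exp (-y)) ^ (1 / 2 : ℂ) *
            Complex.exp (β / 24 - dilog (Complex.exp (-y)) / β) * P) ∧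
    -- the identity for branches continued analytically along any path in `ℂ ∖ 2πiℤ` from a
    -- point of the right half-plane, where all branches are the principal ones
    (∀ (a y : ℂ) (γ : Path a y), 0 < a.re → (∀ t, ∀ n : ℤ, shiftPt (γ t) n ≠ 0) →
      ∀ (d r : ℂ) (p : ℤ → ℂ),
        ContinuesTo γ (fun w => dilog (Complex.exp (-w))) d →
        ContinuesTo γ (fun w => (1 - Complex.exp (-w)) ^ (1 / 2 : ℂ)) r →
        (∀ n : ℤ, ContinuesTo γ
          (fun w => (shiftPt w n / β) ^ (shiftPt w n / β - 1 / 2)) (p n)) →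
        ∃ P : ℂ,
          HasProd (fun n : ℤ =>
              (Real.sqrt (2 * Real.pi) : ℂ) / Complex.Gamma (shiftPt y n / β) * p n *
                Complex.exp (-(shiftPt y n / β))) P (SummationFilter.symmetricIcc ℤ) ∧
          qPochhammerInf (Complex.exp (-y)) (Complex.exp (-β)) =
            r * Complex.exp (β / 24 - d / β) * P) ∧
    -- the product identity obtained from the quotient at `y` and `y + β`, same explicit branches;
    -- the product converges unconditionally
    (∀ y : ℂ, (∀ n : ℤ, shiftPt y n ≠ 0) → (∀ n : ℤ, shiftPt (y + β) n ≠ 0) →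
      HasProd (fun n : ℤ =>
          Complex.exp (-1) *
            quotPow (shiftPt (y + β) n) (shiftPt y n) (shiftPt y n / β + 1 / 2))
        (Complex.exp ((dilog (Complex.exp (-y - β)) - dilog (Complex.exp (-y))) / β) /
          ((1 - Complex.exp (-y)) ^ (1 / 2 : ℂ) * (1 - Complex.exp (-y - β)) ^ (1 / 2 : ℂ)))) ∧
    -- the product identity for branches continued along paths
    (∀ (a y : ℂ) (γ : Path a y), 0 < a.re → (∀ t, ∀ n : ℤ, shiftPt (γ t) n ≠ 0) →
      (∀ t, ∀ n : ℤ, shiftPt (γ t + β) n ≠ 0) →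
      ∀ (d₀ d₁ r₀ r₁ : ℂ) (p : ℤ → ℂ),
        ContinuesTo γ (fun w => dilog (Complex.exp (-w))) d₀ →
        ContinuesTo γ (fun w => dilog (Complex.exp (-w - β))) d₁ →
        ContinuesTo γ (fun w => (1 - Complex.exp (-w)) ^ (1 / 2 : ℂ)) r₀ →
        ContinuesTo γ (fun w => (1 - Complex.exp (-w - β)) ^ (1 / 2 : ℂ)) r₁ →
        (∀ n : ℤ, ContinuesTo γ
          (fun w => (1 + β / shiftPt w n) ^ (shiftPt w n / β + 1 / 2)) (p n)) →
        HasProd (fun n : ℤ => Complex.exp (-1) * p n)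
          (Complex.exp ((d₁ - d₀) / β) / (r₀ * r₁))) := by
  have hβ0 : β ≠ 0 := fun h => by simp [h] at hβ
  refine ⟨fun y hy => ?_, fun y hy => ?_, fun a y γ ha hγ d r p hd hr hp =>
    hasProd_gammaFactor_of_continuesTo hβ γ ha hγ hd hr hp, fun y hy hyβ => ?_,
    fun a y γ ha hγ hγβ d₀ d₁ r₀ r₁ p hd₀ hd₁ hr₀ hr₁ hp =>
      hasProd_exp_logFactor_of_continuesTo hβ γ ha hγ hγβ hd₀ hd₁ hr₀ hr₁ hp⟩
  · have h := (hasSum_inv_shiftPt hy).mul_left (β / 12)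
    have e : β / 12 * (Complex.cosh (y / 2) / Complex.sinh (y / 2) / 2) =
        β * (Complex.cosh (y / 2) / Complex.sinh (y / 2)) / 24 := by ring
    rw [e] at h
    simpa only [mul_one_div, div_div] using h
  · refine ⟨_, hasProd_gammaFactor hβ hy, ?_⟩
    rw [one_sub_exp_neg_cpow_half hy, dilogExp, mul_comm (qPochhammerInf _ _), ← mul_assoc,
      ← Complex.exp_add, ← Complex.exp_add]
    conv_lhs => rw [← one_mul (qPochhammerInf _ _), ← Complex.exp_zero]
    congr 2
    ring
  · convert (hasSum_logFactor hβ0 hy hyβ).cexp using 1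
    · funext n
      rw [quotPow, Function.comp_apply, logFactor, ← Complex.exp_add]
      congr 1
      ring
    · have e : -y - β = -(y + β) := by ring
      rw [e, one_sub_exp_neg_cpow_half hy, one_sub_exp_neg_cpow_half hyβ, ← Complex.exp_add,
        ← Complex.exp_sub, dilogExp, dilogExp]
      congr 1
      ring
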